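/- Let $G$ be a finite abelian group acting by $\mathbb{C}$-algebra automorphisms on $A=M_n(\mathbb{C})$, $n\ge 1$, and let $A'=G\ltimes A$ be the crossed product, i.e. the algebra of formal sums $\sum_{g\in G}a_g\,g$ with $(a\,g)(b\,h)=a\,g(b)\,gh$. Let $K_0(A')$ be the Grothendieck group of finitely generated projective left $A'$-modules and let $K_1(A')=\varinjlim_m\pi_0(GL_m(A'))$ be the topological $K_1$-group of the finite-dimensional (Banach) algebra $A'$. Let $R(G)$ be the complex representation ring of $G$; it acts on $K_0(A')$ by $[V]\cdot[E]=[V\otimes_{\mathbb{C}}E]$, where $a\in A$ acts on $V\otimes_{\mathbb{C}} E$ by $1\otimes a$ and $g\in G$ acts diagonally. Let $$\widetilde G=\{(g,u)\in G\times SL_n(\mathbb{C}) : g(a)=u\,a\,u^{-1}\text{ for all }a\in A\}$$ be the associated central extension of $G$ by the group $\mu_n$ of $n$-th roots of unity (if $G$ acts by $*$-automorphisms, i.e. through $PU(n)$, then $\widetilde G$ is the pull-back of $SU(n)\to PU(n)$ along $G\to PU(n)$), and let $G'\subseteq G$ be the image of the center of $\widetilde G$. Then: 1. The complex topological $K$-theory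 $K_*(A')=K_0(A')\oplus K_1(A')$ is concentrated in degree $0$, i.e. $K_1(A')=0$, and $K_0(A')$ is a finitely generated free $\mathbb{Z}$-module. 2. The ring $R(G)\otimes\mathbb{Q}$ is isomorphic to the group algebra $\mathbb{Q}[G]$, and, as an $R(G)\otimes\mathbb{Q}$-module, $K_0(A')\otimes\mathbb{Q}$ is isomorphic to $R(G')\otimes\mathbb{Q}$, on which $R(G)\otimes\mathbb{Q}$ acts through restriction of representations from $G$ to $G'$. 3. In particular, the rank of $K_0(A')$ divides $|G|$. -/

import Mathlib

open scoped TensorProduct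

noncomputable section

namespace TwistedK

universe u v w

/-! ### Grothendieck groups of semirings and of modules over them -/

section Grothendieck

open Algebra (GrothendieckAddGroup)

theorem groth_hom_ext {M N : Type*} [AddCommMonoid M] [AddCommGroup N]
    {f g : GrothendieckAddGroup M →+ N}
    (h : ∀ m, f (GrothendieckAddGroup.of m) = g (GrothendieckAddGroup.of m)) : f = g :=
  GrothendieckAddGroup.lift.symm.injective (AddMonoidHom.ext h)

theorem groth_lift_of {M N : Type*} [AddCommMonoid M] [AddCommGroup N] (f : M →+ N) (m : M) :
    GrothendieckAddGroup.lift f (GrothendieckAddGroup.of m) = f m :=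
  DFunLike.congr_fun (GrothendieckAddGroup.lift.symm_apply_apply f) m

/-- The biadditive extension to Grothendieck groups of the action of a semiring `S` on an
`S`-semimodule `M`. -/
def grothAct (S M : Type*) [Semiring S] [AddCommMonoid M] [Module S M] :
    GrothendieckAddGroup S →+ GrothendieckAddGroup M →+ GrothendieckAddGroup M :=
  GrothendieckAddGroup.lift
    { toFun := fun s => GrothendieckAddGroup.lift
        ((GrothendieckAddGroup.of (M := M)).comp (DistribSMul.toAddMonoidHom M s))
      map_zero' := groth_hom_ext fun m => by
        rw [groth_lift_of]; simp
      map_add' := fun s t => groth_hom_ext fun m => by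
        rw [AddMonoidHom.add_apply]; simp only [groth_lift_of]; simp [add_smul] }

theorem grothAct_of_of {S M : Type*} [Semiring S] [AddCommMonoid M] [Module S M] (s : S) (m : M) :
    grothAct S M (GrothendieckAddGroup.of s) (GrothendieckAddGroup.of m) =
      GrothendieckAddGroup.of (s • m) := by
  rw [grothAct, groth_lift_of]
  exact groth_lift_of _ _

theorem groth_induction {M : Type*} [AddCommMonoid M] {p : GrothendieckAddGroup M → Prop}
    (h : ∀ m, p (GrothendieckAddGroup.of m)) (hsub : ∀ x y, p x → p y → p (x - y))
    (x : GrothendieckAddGroup M) : p x := by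
  induction x using AddLocalization.ind with
  | _ y =>
    have hy : AddLocalization.mk y.1 y.2 =
        GrothendieckAddGroup.of y.1 - GrothendieckAddGroup.of (y.2 : M) := by
      rw [eq_sub_iff_add_eq, GrothendieckAddGroup.of, AddSubmonoid.LocalizationMap.toAddMonoidHom_apply,
        AddSubmonoid.LocalizationMap.toAddMonoidHom_apply, AddLocalization.mk_eq_addMonoidOf_mk']
      exact AddSubmonoid.LocalizationMap.mk'_spec _ _ _
    rw [hy]
    exact hsub _ _ (h _) (h _)

theorem grothAct_one {S M : Type*} [Semiring S] [AddCommMonoid M] [Module S M]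
    (x : GrothendieckAddGroup M) : grothAct S M (GrothendieckAddGroup.of 1) x = x := by
  induction x using groth_induction with
  | h m => rw [grothAct_of_of, one_smul]
  | hsub x y hx hy => rw [map_sub, hx, hy]

theorem grothAct_assoc {S M : Type*} [Semiring S] [AddCommMonoid M] [Module S M]
    (a b : GrothendieckAddGroup S) (x : GrothendieckAddGroup M) :
    grothAct S M (grothAct S S a b) x = grothAct S M a (grothAct S M b x) := by
  induction a using groth_induction with
  | hsub a a' h h' => simp only [map_sub, AddMonoidHom.sub_apply, h, h']
  | h s =>
  induction b using groth_induction with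
  | hsub a a' h h' => simp only [map_sub, AddMonoidHom.sub_apply, h, h']
  | h t =>
  induction x using groth_induction with
  | hsub a a' h h' => simp only [map_sub, h, h']
  | h m => simp only [grothAct_of_of, smul_smul, smul_eq_mul]

theorem grothAct_comm {S : Type*} [CommSemiring S] (a b : GrothendieckAddGroup S) :
    grothAct S S a b = grothAct S S b a := by
  induction a using groth_induction with
  | hsub a a' h h' => simp only [map_sub, AddMonoidHom.sub_apply, h, h']
  | h s =>
  induction b using groth_induction with
  | hsub a a' h h' => simp only [map_sub, AddMonoidHom.sub_apply, h, h']
  | h t => simp only [grothAct_of_of, smul_eq_mul, mul_comm]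

/-- The Grothendieck ring of a commutative semiring. -/
instance grothCommRing (S : Type*) [CommSemiring S] : CommRing (GrothendieckAddGroup S) where
  __ := (inferInstance : AddCommGroup (GrothendieckAddGroup S))
  mul a b := grothAct S S a b
  one := GrothendieckAddGroup.of 1
  mul_assoc a b c := grothAct_assoc a b c
  one_mul a := grothAct_one a
  mul_one a := (grothAct_comm a _).trans (grothAct_one a)
  left_distrib a b c := map_add (grothAct S S a) b c
  right_distrib a b c := DFunLike.congr_fun (map_add (grothAct S S) a b) c
  zero_mul a := DFunLike.congr_fun (map_zero (grothAct S S)) a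
  mul_zero a := map_zero (grothAct S S a)
  mul_comm a b := grothAct_comm a b

/-- The Grothendieck group of a semimodule is a module over the Grothendieck ring. -/
abbrev grothModule (S M : Type*) [CommSemiring S] [AddCommMonoid M] [Module S M] :
    Module (GrothendieckAddGroup S) (GrothendieckAddGroup M) where
  smul a x := grothAct S M a x
  one_smul x := grothAct_one x
  mul_smul a b x := grothAct_assoc a b x
  smul_zero a := map_zero (grothAct S M a)
  smul_add a x y := map_add (grothAct S M a) x y
  add_smul a b x := DFunLike.congr_fun (map_add (grothAct S M) a b) x
  zero_smul x := DFunLike.congr_fun (map_zero (grothAct S M)) x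

/-- Functoriality of the Grothendieck ring. -/
def grothMap {S T : Type*} [CommSemiring S] [CommSemiring T] (f : S →+* T) :
    GrothendieckAddGroup S →+* GrothendieckAddGroup T where
  __ := GrothendieckAddGroup.lift ((GrothendieckAddGroup.of (M := T)).comp f.toAddMonoidHom)
  map_one' := by
    refine (groth_lift_of _ (1 : S)).trans ?_
    change GrothendieckAddGroup.of (f 1) = GrothendieckAddGroup.of 1
    rw [map_one]
  map_mul' a b := by
    let F : GrothendieckAddGroup S →+ GrothendieckAddGroup T :=
      GrothendieckAddGroup.lift ((GrothendieckAddGroup.of (M := T)).comp f.toAddMonoidHom)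
    have hF : ∀ s, F (GrothendieckAddGroup.of s) = GrothendieckAddGroup.of (f s) :=
      fun s => groth_lift_of _ s
    change F (grothAct S S a b) = grothAct T T (F a) (F b)
    induction a using groth_induction with
    | hsub a a' h h' => simp only [map_sub, AddMonoidHom.sub_apply, h, h']
    | h s =>
    induction b using groth_induction with
    | hsub a a' h h' => simp only [map_sub, h, h']
    | h t => rw [grothAct_of_of, hF, hF, hF, grothAct_of_of, smul_eq_mul, smul_eq_mul, map_mul]

end Grothendieck

/-! ### The representation ring -/

section RepRing

/-- A finite-dimensional complex representation of `G`. -/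
structure FinRep (G : Type u) [Group G] where
  carrier : Type
  [addCommGroup : AddCommGroup carrier]
  [module : Module ℂ carrier]
  [finite : Module.Finite ℂ carrier]
  ρ : Representation ℂ G carrier

attribute [instance] FinRep.addCommGroup FinRep.module FinRep.finite

variable (G : Type u) [Group G]

instance FinRep.setoid : Setoid (FinRep G) where
  r V W := Nonempty (V.ρ.Equiv W.ρ)
  iseqv := ⟨fun _ => ⟨.refl _⟩, fun ⟨e⟩ => ⟨e.symm⟩, fun ⟨e⟩ ⟨f⟩ => ⟨e.trans f⟩⟩

/-- Isomorphism classes of finite-dimensional complex representations of `G`. -/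
def RepClass : Type (max 1 u) := Quotient (FinRep.setoid G)

variable {G}

/-- Two representations related by an equivariant linear isomorphism have the same class. -/
theorem RepClass.sound {V W : FinRep G} (e : V.carrier ≃ₗ[ℂ] W.carrier)
    (h : ∀ g v, e (V.ρ g v) = W.ρ g (e v)) :
    (Quotient.mk (FinRep.setoid G) V : RepClass G) = Quotient.mk (FinRep.setoid G) W :=
  Quotient.sound ⟨.mk e fun g => LinearMap.ext fun v => h g v⟩

/-- Equivariance of an isomorphism out of a tensor product is checked on pure tensors. -/
theorem equivariant_of_tmul {V W U : Type*} [AddCommGroup V] [AddCommGroup W] [AddCommGroup U]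
    [Module ℂ V] [Module ℂ W] [Module ℂ U] (e : V ⊗[ℂ] W →ₗ[ℂ] U) (f : V ⊗[ℂ] W →ₗ[ℂ] V ⊗[ℂ] W)
    (g : U →ₗ[ℂ] U) (h : ∀ v w, e (f (v ⊗ₜ w)) = g (e (v ⊗ₜ w))) (x : V ⊗[ℂ] W) :
    e (f x) = g (e x) :=
  LinearMap.congr_fun (TensorProduct.ext' (g := e ∘ₗ f) (h := g ∘ₗ e) h) x

/-- Direct sum of representations. -/
def FinRep.sum (V W : FinRep G) : FinRep G := ⟨V.carrier × W.carrier, V.ρ.prod W.ρ⟩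

/-- Tensor product of representations, with the diagonal action. -/
def FinRep.tensor (V W : FinRep G) : FinRep G := ⟨V.carrier ⊗[ℂ] W.carrier, V.ρ.tprod W.ρ⟩

instance : Add (RepClass G) where
  add := Quotient.map₂ FinRep.sum fun _ _ ⟨e⟩ _ _ ⟨f⟩ =>
    ⟨.mk (e.toLinearEquiv.prodCongr f.toLinearEquiv) fun g => LinearMap.ext fun v =>
      Prod.ext (Representation.IntertwiningMap.isIntertwining _ _ e.toIntertwiningMap g v.1) (Representation.IntertwiningMap.isIntertwining _ _ f.toIntertwiningMap g v.2)⟩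

instance : Mul (RepClass G) where
  mul := Quotient.map₂ FinRep.tensor fun _ _ ⟨e⟩ _ _ ⟨f⟩ =>
    ⟨.mk (TensorProduct.congr e.toLinearEquiv f.toLinearEquiv) fun g =>
      TensorProduct.ext' fun v w =>
        congrArg₂ (· ⊗ₜ[ℂ] ·) (Representation.IntertwiningMap.isIntertwining _ _ e.toIntertwiningMap g v)
          (Representation.IntertwiningMap.isIntertwining _ _ f.toIntertwiningMap g w)⟩

instance : Zero (RepClass G) := ⟨Quotient.mk _ ⟨PUnit, .trivial ℂ G PUnit⟩⟩

instance : One (RepClass G) := ⟨Quotient.mk _ ⟨ℂ, .trivial ℂ G ℂ⟩⟩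

theorem RepClass.left_distrib' (a b c : RepClass G) : a * (b + c) = a * b + a * c := by
  induction a using Quotient.inductionOn with | _ U
  induction b using Quotient.inductionOn with | _ V
  induction c using Quotient.inductionOn with | _ W
  refine RepClass.sound (V := U.tensor (V.sum W)) (W := (U.tensor V).sum (U.tensor W))
    (TensorProduct.prodRight ℂ ℂ U.carrier V.carrier W.carrier) fun g x => ?_
  exact equivariant_of_tmul (TensorProduct.prodRight ℂ ℂ U.carrier V.carrier W.carrier).toLinearMap
    ((U.tensor (V.sum W)).ρ g) (((U.tensor V).sum (U.tensor W)).ρ g) (fun u w => rfl) x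

theorem RepClass.mul_comm' (a b : RepClass G) : a * b = b * a := by
  induction a using Quotient.inductionOn with | _ U
  induction b using Quotient.inductionOn with | _ V
  exact Quotient.sound ⟨Representation.TensorProduct.comm U.ρ V.ρ⟩

theorem RepClass.zero_mul' (a : RepClass G) : 0 * a = 0 := by
  induction a using Quotient.inductionOn with | _ U
  have : Subsingleton (PUnit.{1} ⊗[ℂ] U.carrier) := inferInstance
  refine RepClass.sound (V := FinRep.tensor ⟨PUnit, .trivial ℂ G PUnit⟩ U)
    (W := ⟨PUnit, .trivial ℂ G PUnit⟩)
    (LinearEquiv.ofSubsingleton (PUnit.{1} ⊗[ℂ] U.carrier) PUnit.{1}) fun g x => ?_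
  exact Subsingleton.elim (α := PUnit) _ _

/-- Isomorphism classes of representations form a commutative semiring under `⊕` and `⊗`. -/
instance : CommSemiring (RepClass G) where
  add_assoc a b c := by
    induction a using Quotient.inductionOn with | _ U
    induction b using Quotient.inductionOn with | _ V
    induction c using Quotient.inductionOn with | _ W
    exact RepClass.sound (V := (U.sum V).sum W) (W := U.sum (V.sum W))
      (LinearEquiv.prodAssoc ℂ U.carrier V.carrier W.carrier) fun g x => rfl
  zero_add a := by
    induction a using Quotient.inductionOn with | _ U
    exact RepClass.sound (V := FinRep.sum ⟨PUnit, .trivial ℂ G PUnit⟩ U) (W := U)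
      (LinearEquiv.uniqueProd (R := ℂ) (M := U.carrier) (M₂ := PUnit)) fun g x => rfl
  add_zero a := by
    induction a using Quotient.inductionOn with | _ U
    exact RepClass.sound (V := FinRep.sum U ⟨PUnit, .trivial ℂ G PUnit⟩) (W := U)
      (LinearEquiv.prodUnique (R := ℂ) (M := U.carrier) (M₂ := PUnit)) fun g x => rfl
  add_comm a b := by
    induction a using Quotient.inductionOn with | _ U
    induction b using Quotient.inductionOn with | _ V
    exact RepClass.sound (V := U.sum V) (W := V.sum U)
      (LinearEquiv.prodComm ℂ U.carrier V.carrier) fun g x => rfl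
  nsmul := nsmulRec
  left_distrib := RepClass.left_distrib'
  right_distrib a b c := by
    rw [RepClass.mul_comm', RepClass.left_distrib', RepClass.mul_comm' c a, RepClass.mul_comm' c b]
  zero_mul := RepClass.zero_mul'
  mul_zero a := (RepClass.mul_comm' a 0).trans (RepClass.zero_mul' a)
  mul_assoc a b c := by
    induction a using Quotient.inductionOn with | _ U
    induction b using Quotient.inductionOn with | _ V
    induction c using Quotient.inductionOn with | _ W
    exact Quotient.sound ⟨Representation.TensorProduct.assoc U.ρ V.ρ W.ρ⟩
  one_mul a := by
    induction a using Quotient.inductionOn with | _ U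
    exact Quotient.sound ⟨Representation.TensorProduct.lid ℂ U.ρ⟩
  mul_one a := by
    induction a using Quotient.inductionOn with | _ U
    exact Quotient.sound ⟨Representation.TensorProduct.rid ℂ U.ρ⟩
  mul_comm := RepClass.mul_comm'

/-- Restriction of a representation to a subgroup. -/
def FinRep.res (H : Subgroup G) (V : FinRep G) : FinRep H := ⟨V.carrier, V.ρ.comp H.subtype⟩

/-- Restriction on isomorphism classes. -/
def RepClass.res (H : Subgroup G) : RepClass G →+* RepClass H where
  toFun := Quotient.map (FinRep.res H) fun _ _ ⟨e⟩ =>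
    ⟨.mk e.toLinearEquiv fun g => LinearMap.ext fun v => Representation.IntertwiningMap.isIntertwining _ _ e.toIntertwiningMap g v⟩
  map_one' := rfl
  map_mul' a b := Quotient.inductionOn₂ a b fun _ _ => rfl
  map_zero' := rfl
  map_add' a b := Quotient.inductionOn₂ a b fun _ _ => rfl

variable (G) in
/-- The complex representation ring `R(G)`. -/
abbrev RepRing : Type (max 1 u) := Algebra.GrothendieckAddGroup (RepClass G)

/-- The restriction homomorphism `R(G) → R(H)`. -/
def RepRing.res (H : Subgroup G) : RepRing G →+* RepRing H := grothMap (RepClass.res H)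

/-- `R(H) ⊗ ℚ` as a module over `R(G) ⊗ ℚ`, through restriction of representations. -/
instance repRingRatModule (H : Subgroup G) :
    Module (RepRing G ⊗[ℤ] ℚ) (RepRing H ⊗[ℤ] ℚ) :=
  Module.compHom _ (Algebra.TensorProduct.map (RepRing.res H).toIntAlgHom
    (AlgHom.id ℤ ℚ)).toRingHom

end RepRing

/-! ### The group `K₀` of a ring -/

section KZero

/-- A finitely generated projective left `R`-module. -/
structure FGProj (R : Type u) [Ring R] where
  carrier : Type u
  [addCommGroup : AddCommGroup carrier]
  [module : Module R carrier]
  [finite : Module.Finite R carrier]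
  [projective : Module.Projective R carrier]

attribute [instance] FGProj.addCommGroup FGProj.module FGProj.finite FGProj.projective

variable (R : Type u) [Ring R]

instance FGProj.setoid : Setoid (FGProj R) where
  r E F := Nonempty (E.carrier ≃ₗ[R] F.carrier)
  iseqv := ⟨fun _ => ⟨.refl _ _⟩, fun ⟨e⟩ => ⟨e.symm⟩, fun ⟨e⟩ ⟨f⟩ => ⟨e.trans f⟩⟩

/-- Isomorphism classes of finitely generated projective left `R`-modules. -/
def ProjClass : Type (u + 1) := Quotient (FGProj.setoid R)

variable {R}

/-- Direct sum of finitely generated projective modules. -/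
def FGProj.sum (E F : FGProj R) : FGProj R := ⟨E.carrier × F.carrier⟩

/-- The zero module. -/
def FGProj.zero : FGProj R := ⟨PUnit⟩

instance : Add (ProjClass R) where
  add := Quotient.map₂ FGProj.sum fun _ _ ⟨e⟩ _ _ ⟨f⟩ => ⟨e.prodCongr f⟩

instance : Zero (ProjClass R) := ⟨Quotient.mk _ FGProj.zero⟩

/-- Isomorphism classes of finitely generated projective modules form a commutative monoid
under direct sum. -/
instance : AddCommMonoid (ProjClass R) where
  add_assoc a b c := by
    induction a using Quotient.inductionOn with | _ U
    induction b using Quotient.inductionOn with | _ V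
    induction c using Quotient.inductionOn with | _ W
    exact Quotient.sound ⟨LinearEquiv.prodAssoc R U.carrier V.carrier W.carrier⟩
  zero_add a := by
    induction a using Quotient.inductionOn with | _ U
    exact Quotient.sound
      ⟨(LinearEquiv.uniqueProd (R := R) (M := U.carrier) (M₂ := PUnit.{u + 1}) :)⟩
  add_zero a := by
    induction a using Quotient.inductionOn with | _ U
    exact Quotient.sound
      ⟨(LinearEquiv.prodUnique (R := R) (M := U.carrier) (M₂ := PUnit.{u + 1}) :)⟩
  add_comm a b := by
    induction a using Quotient.inductionOn with | _ U
    induction b using Quotient.inductionOn with | _ V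
    exact Quotient.sound ⟨LinearEquiv.prodComm R U.carrier V.carrier⟩
  nsmul := nsmulRec

variable (R) in
/-- `K₀(R)`, the Grothendieck group of finitely generated projective left `R`-modules. -/
abbrev K0 : Type (u + 1) := Algebra.GrothendieckAddGroup (ProjClass R)

end KZero

/-! ### The topological group `K₁` of a topological ring -/

section KOne

variable {R : Type u} [Ring R]

/-- The stabilization `u ↦ u ⊕ 1` from `m × m` to `k × k` matrices, for `m ≤ k`. -/
def stabMatrix (m k : ℕ) (u : Matrix (Fin m) (Fin m) R) : Matrix (Fin k) (Fin k) R :=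
  Matrix.of fun i j =>
    if h : (i : ℕ) < m ∧ (j : ℕ) < m then u ⟨i, h.1⟩ ⟨j, h.2⟩ else if i = j then 1 else 0

theorem stabMatrix_one (m k : ℕ) : stabMatrix m k (1 : Matrix (Fin m) (Fin m) R) = 1 := by
  ext i j
  simp only [stabMatrix, Matrix.of_apply, Matrix.one_apply, Fin.ext_iff]
  split_ifs <;> rfl

theorem stabMatrix_eq_fromBlocks (m d : ℕ) (u : Matrix (Fin m) (Fin m) R) :
    stabMatrix m (m + d) u =
      Matrix.reindex finSumFinEquiv finSumFinEquiv (Matrix.fromBlocks u 0 0 1) := by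
  ext i j
  obtain ⟨i, rfl⟩ := finSumFinEquiv.surjective i
  obtain ⟨j, rfl⟩ := finSumFinEquiv.surjective j
  rw [Matrix.reindex_apply, Matrix.submatrix_apply, Equiv.symm_apply_apply, Equiv.symm_apply_apply]
  rcases i with i | i <;> rcases j with j | j <;>
    simp [stabMatrix, Fin.ext_iff, Matrix.one_apply] <;> omega

theorem stabMatrix_mul {m k : ℕ} (h : m ≤ k) (u v : Matrix (Fin m) (Fin m) R) :
    stabMatrix m k (u * v) = stabMatrix m k u * stabMatrix m k v := by
  obtain ⟨d, rfl⟩ := Nat.exists_eq_add_of_le h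
  simp only [stabMatrix_eq_fromBlocks, Matrix.reindex_apply, Matrix.submatrix_mul_equiv,
    Matrix.fromBlocks_multiply]
  simp

theorem stabMatrix_self (m : ℕ) (u : Matrix (Fin m) (Fin m) R) : stabMatrix m m u = u := by
  ext i j
  simp [stabMatrix]

theorem stabMatrix_stabMatrix {m k l : ℕ} (h : m ≤ k) (u : Matrix (Fin m) (Fin m) R) :
    stabMatrix k l (stabMatrix m k u) = stabMatrix m l u := by
  ext i j
  simp only [stabMatrix, Matrix.of_apply, Fin.ext_iff]
  split_ifs <;> first | rfl | omega

/-- Stabilization `GL_m(R) → GL_k(R)`. -/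
def stabGL {m k : ℕ} (h : m ≤ k) :
    (Matrix (Fin m) (Fin m) R)ˣ →* (Matrix (Fin k) (Fin k) R)ˣ :=
  Units.map
    { toFun := stabMatrix m k
      map_one' := stabMatrix_one m k
      map_mul' := stabMatrix_mul h }

theorem continuous_stabGL [TopologicalSpace R] {m k : ℕ} (h : m ≤ k) : Continuous (stabGL (R := R) h) := by
  refine Continuous.units_map _ ?_
  refine continuous_matrix fun i j => ?_
  by_cases hij : (i : ℕ) < m ∧ (j : ℕ) < m
  · simpa [stabMatrix, hij] using! continuous_id.matrix_elem _ _
  · simpa [stabMatrix, hij] using! continuous_const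

variable [TopologicalSpace R] [IsTopologicalRing R]

variable (R) in
/-- `π₀(GL_m(R))`: invertible matrices modulo the path component of the identity. -/
abbrev PiZeroGL (m : ℕ) : Type u :=
  (Matrix (Fin m) (Fin m) R)ˣ ⧸ Subgroup.pathComponentOne (Matrix (Fin m) (Fin m) R)ˣ

variable (R) in
/-- Stabilization on path components. -/
def stabPiZero (m k : ℕ) (h : m ≤ k) : PiZeroGL R m →* PiZeroGL R k :=
  QuotientGroup.map _ _ (stabGL h) fun u hu => by
    have : Joined (stabGL (R := R) h 1) (stabGL h u) := Joined.map hu (continuous_stabGL h)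
    rwa [map_one] at this

instance : DirectedSystem (PiZeroGL R) (stabPiZero R · · ·) where
  map_self m x := by
    induction x using QuotientGroup.induction_on with | _ u
    refine congrArg QuotientGroup.mk (Units.ext ?_)
    exact stabMatrix_self m _
  map_map k m l h h' x := by
    induction x using QuotientGroup.induction_on with | _ u
    refine congrArg QuotientGroup.mk (Units.ext ?_)
    exact stabMatrix_stabMatrix h _

variable (R) in
/-- Topological `K₁` of a unital Banach (more generally, topological) algebra: the direct limit
of the groups `π₀(GL_m(R))`, written multiplicatively. -/
abbrev K1 : Type u := DirectLimit (PiZeroGL R) (stabPiZero R)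

end KOne

/-! ### Crossed products -/

section Crossed

open SkewMonoidAlgebra

/-- The topology of coefficientwise convergence on the crossed product. -/
instance crossedTopology {G A : Type*} [Ring A] [TopologicalSpace A] : TopologicalSpace (SkewMonoidAlgebra A G) :=
  TopologicalSpace.induced (fun f g => f.coeff g) inferInstance

/-- For a finite group acting continuously, the crossed product is a topological ring. -/
theorem crossed_isTopologicalRing {G : Type*} [Group G] {A : Type*} [Ring A]
    [MulSemiringAction G A] [Finite G] [TopologicalSpace A] [IsTopologicalRing A]
    [ContinuousConstSMul G A] : IsTopologicalRing (SkewMonoidAlgebra A G) := by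
  classical
  have := Fintype.ofFinite G
  have hc : ∀ g : G, Continuous fun f : SkewMonoidAlgebra A G => f.coeff g := fun g =>
    (continuous_apply g).comp continuous_induced_dom
  refine { continuous_add := ?_, continuous_mul := ?_, continuous_neg := ?_ }
  · refine continuous_induced_rng.2 (continuous_pi fun g => ?_)
    have : (fun p : SkewMonoidAlgebra A G × SkewMonoidAlgebra A G => (p.1 + p.2).coeff g) =
        fun p => p.1.coeff g + p.2.coeff g := by
      funext p
      rw [coeff_add, Finsupp.add_apply]
    exact this ▸ ((hc g).comp continuous_fst).add ((hc g).comp continuous_snd)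
  · refine continuous_induced_rng.2 (continuous_pi fun g => ?_)
    have : ((fun (f : SkewMonoidAlgebra A G) g => f.coeff g) ∘
        fun p : SkewMonoidAlgebra A G × SkewMonoidAlgebra A G => p.1 * p.2) = fun p g =>
        ∑ h : G, p.1.coeff h * h • p.2.coeff (h⁻¹ * g) := by
      funext p g
      simp only [Function.comp_apply, coeff_mul_left]
      rw [SkewMonoidAlgebra.sum_def', Finset.sum_subset (Finset.subset_univ _)]
      intro h _ hh
      rw [notMem_support_iff.1 hh, zero_mul]
    rw [this]
    refine continuous_finsetSum _ fun h _ => ?_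
    exact ((hc h).comp continuous_fst).mul (((hc _).comp continuous_snd).const_smul h)
  · refine continuous_induced_rng.2 (continuous_pi fun g => ?_)
    exact (hc g).neg

variable {G : Type u} [Group G] {A : Type v} [Ring A] [Algebra ℂ A] [MulSemiringAction G A]
  [SMulCommClass G ℂ A]

/-- Averaging over the finite group `G`: if `A` is semisimple, every surjection of modules over the
crossed product splits. -/
theorem crossed_split [Finite G] [IsSemisimpleRing A] {F P : Type*} [AddCommGroup F]
    [AddCommGroup P] [Module (SkewMonoidAlgebra A G) F] [Module (SkewMonoidAlgebra A G) P]
    (p : F →ₗ[SkewMonoidAlgebra A G] P) (hsurj : Function.Surjective p) :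
    ∃ T : P →ₗ[SkewMonoidAlgebra A G] F, p ∘ₗ T = LinearMap.id := by
  classical
  have := Fintype.ofFinite G
  let B := SkewMonoidAlgebra A G
  let ι : A →+* B := singleOneRingHom
  let : Module A P := Module.compHom P ι
  let : Module A F := Module.compHom F ι
  let pA : F →ₗ[A] P :=
    { toFun := p, map_add' := map_add p, map_smul' := fun a x => map_smul p (ι a) x }
  have hp : Function.Surjective pA := hsurj
  have := Module.projective_of_isSemisimpleRing A P
  obtain ⟨s, hs⟩ := Module.projective_lifting_property pA LinearMap.id hp
  have hs' : ∀ x, p (s x) = x := fun x => LinearMap.congr_fun hs x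
  have hsA : ∀ (a : A) x, s ((single 1 a : B) • x) = (single 1 a : B) • s x := fun a x =>
    map_smul s a x
  let c : B := algebraMap ℂ B ((Fintype.card G : ℂ)⁻¹)
  have hc : ∀ b : B, b * c = c * b := fun b => (Algebra.commutes _ b).symm
  let t : P →+ F :=
    { toFun := fun x => ∑ g : G, (single g 1 : B) • s ((single g⁻¹ 1 : B) • x)
      map_zero' := by simp
      map_add' := fun x y => by simp [Finset.sum_add_distrib] }
  have ht : ∀ (b : B) x, t (b • x) = b • t x := by
    intro b x
    induction b using SkewMonoidAlgebra.induction_on with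
    | zero => simp
    | add f g hf hg => rw [add_smul, map_add, hf, hg, add_smul]
    | single h a =>
      change ∑ g : G, (single g 1 : B) • s ((single g⁻¹ 1 : B) • (single h a : B) • x) =
        (single h a : B) • ∑ g : G, (single g 1 : B) • s ((single g⁻¹ 1 : B) • x)
      rw [Finset.smul_sum, ← Equiv.sum_comp (Equiv.mulLeft h)]
      refine Finset.sum_congr rfl fun g _ => ?_
      have h1 : (single (h * g)⁻¹ 1 : B) * single h a =
          single 1 ((h * g)⁻¹ • a) * single g⁻¹ 1 := by
        simp
      have h2 : (single (h * g) 1 : B) * single 1 ((h * g)⁻¹ • a) = single h a * single g 1 := by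
        simp [smul_smul]
      rw [Equiv.coe_mulLeft, smul_smul, h1, mul_smul, hsA, smul_smul, h2, mul_smul]
  let T : P →ₗ[B] F :=
    { toFun := fun x => c • t x
      map_add' := fun x y => by rw [map_add, smul_add]
      map_smul' := fun b x => by
        rw [ht, smul_smul, ← hc, mul_smul, RingHom.id_apply] }
  refine ⟨T, LinearMap.ext fun x => ?_⟩
  change p (c • ∑ g : G, (single g 1 : B) • s ((single g⁻¹ 1 : B) • x)) = x
  have h3 : ∀ g : G, (single g 1 : B) * single g⁻¹ 1 = 1 := fun g => by
    rw [single_mul_single]; simp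
  have h4 : c * (Fintype.card G : B) = 1 := by
    change algebraMap ℂ B _ * _ = 1
    rw [← map_natCast (algebraMap ℂ B), ← map_mul, inv_mul_cancel₀ (by simp), map_one]
  simp only [map_smul, _root_.map_sum, hs', smul_smul, h3, one_smul, Finset.sum_const, Finset.card_univ]
  rw [← Nat.cast_smul_eq_nsmul B, smul_smul, h4, one_smul]

/-- If `A` is semisimple, every module over the crossed product is projective. -/
theorem crossed_projective [Finite G] [IsSemisimpleRing A] (P : Type*) [AddCommGroup P]
    [Module (SkewMonoidAlgebra A G) P] : Module.Projective (SkewMonoidAlgebra A G) P := by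
  obtain ⟨T, hT⟩ := crossed_split (Finsupp.linearCombination (SkewMonoidAlgebra A G) (id : P → P))
    (Finsupp.linearCombination_id_surjective _ P)
  exact Module.Projective.of_split T _ hT

instance crossed_finite [Finite G] [Module.Finite ℂ A] : Module.Finite ℂ (SkewMonoidAlgebra A G) :=
  Module.Finite.equiv (SkewMonoidAlgebra.coeffLinearEquiv (S := ℂ) (k := A) (G := G)).symm

/-! ### Tensoring a module over the crossed product with a representation -/

section Twist

variable {V : Type*} [AddCommGroup V] [Module ℂ V] (ρ : Representation ℂ G V)
  (E : Type*) [AddCommGroup E] [Module ℂ E] [Module (SkewMonoidAlgebra A G) E]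
  [IsScalarTower ℂ (SkewMonoidAlgebra A G) E]

variable (A) in
/-- The action of the crossed product on `V ⊗ E`: `a ∈ A` acts by `1 ⊗ a` and `g ∈ G` acts
diagonally by `ρ(g) ⊗ g`. -/
def twistHom : SkewMonoidAlgebra A G →ₐ[ℂ] Module.End ℂ (V ⊗[ℂ] E) :=
  SkewMonoidAlgebra.liftNCAlgHom
    (((Module.End.lTensorAlgHom ℂ E V).comp
      (Algebra.lsmul ℂ ℂ E : SkewMonoidAlgebra A G →ₐ[ℂ] Module.End ℂ E)).comp
      { (singleOneRingHom : A →+* SkewMonoidAlgebra A G) with commutes' := fun _ => rfl })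
    { toFun := fun g =>
        TensorProduct.map (ρ g) (Algebra.lsmul ℂ ℂ E (SkewMonoidAlgebra.of A G g))
      map_one' := by simp [TensorProduct.map_one]
      map_mul' := fun g h => by simp only [map_mul, TensorProduct.map_mul] }
    (by
      intro a g
      refine TensorProduct.ext' fun v e => ?_
      change ρ g v ⊗ₜ[ℂ] ((single 1 (g • a) : SkewMonoidAlgebra A G) •
        (SkewMonoidAlgebra.of A G g • e)) =
        ρ g v ⊗ₜ[ℂ] (SkewMonoidAlgebra.of A G g • (single 1 a : SkewMonoidAlgebra A G) • e)
      rw [smul_smul, smul_smul, of_apply]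
      simp)

theorem twistHom_single (g : G) (a : A) (v : V) (e : E) :
    twistHom A ρ E (single g a) (v ⊗ₜ e) =
      ρ g v ⊗ₜ[ℂ] ((single g a : SkewMonoidAlgebra A G) • e) := by
  have h : twistHom A ρ E (single g a) (v ⊗ₜ e) =
      ρ g v ⊗ₜ[ℂ] ((single 1 a : SkewMonoidAlgebra A G) • (SkewMonoidAlgebra.of A G g • e)) :=
    LinearMap.congr_fun (SkewMonoidAlgebra.liftNC_single _ _ g a) (v ⊗ₜ e)
  rw [h, smul_smul, of_apply]
  simp

end Twist

/-- The underlying complex vector space of a module over the crossed product. -/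
instance crossedComplexModule (E : FGProj (SkewMonoidAlgebra A G)) : Module ℂ E.carrier :=
  Module.compHom E.carrier (algebraMap ℂ (SkewMonoidAlgebra A G))

instance crossedScalarTower (E : FGProj (SkewMonoidAlgebra A G)) :
    IsScalarTower ℂ (SkewMonoidAlgebra A G) E.carrier where
  smul_assoc c b x := by
    rw [Algebra.smul_def, mul_smul]
    rfl

variable [Finite G] [Module.Finite ℂ A] [IsSemisimpleRing A]

/-- The module `V ⊗ E` over the crossed product, for a representation `V` of `G` and a
finitely generated projective module `E`. -/
def twist (V : FinRep G) (E : FGProj (SkewMonoidAlgebra A G)) :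
    FGProj (SkewMonoidAlgebra A G) :=
  letI : Module (SkewMonoidAlgebra A G) (V.carrier ⊗[ℂ] E.carrier) :=
    Module.compHom _ (twistHom A V.ρ E.carrier).toRingHom
  haveI : IsScalarTower ℂ (SkewMonoidAlgebra A G) (V.carrier ⊗[ℂ] E.carrier) :=
    ⟨fun c b x => LinearMap.congr_fun (map_smul (twistHom A V.ρ E.carrier) c b) x⟩
  haveI : Module.Finite ℂ E.carrier := Module.Finite.trans (SkewMonoidAlgebra A G) E.carrier
  haveI : Module.Finite (SkewMonoidAlgebra A G) (V.carrier ⊗[ℂ] E.carrier) :=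
    Module.Finite.of_restrictScalars_finite ℂ _ _
  haveI : Module.Projective (SkewMonoidAlgebra A G) (V.carrier ⊗[ℂ] E.carrier) :=
    crossed_projective _
  ⟨V.carrier ⊗[ℂ] E.carrier⟩

/-- An additive bijection `V ⊗ E ≃ F` is an isomorphism of modules over the crossed product as
soon as it commutes with the elements `a g` on pure tensors. -/
theorem twist_equiv {V : FinRep G} {E F : FGProj (SkewMonoidAlgebra A G)}
    (e : V.carrier ⊗[ℂ] E.carrier ≃+ F.carrier)
    (h : ∀ (g : G) (a : A) v x, e (V.ρ g v ⊗ₜ[ℂ] ((single g a : SkewMonoidAlgebra A G) • x)) =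
      (single g a : SkewMonoidAlgebra A G) • e (v ⊗ₜ[ℂ] x)) :
    Nonempty ((twist V E).carrier ≃ₗ[SkewMonoidAlgebra A G] F.carrier) := by
  have key : ∀ (b : SkewMonoidAlgebra A G) (x : V.carrier ⊗[ℂ] E.carrier),
      e (twistHom A V.ρ E.carrier b x) = b • e x := by
    intro b x
    induction b using SkewMonoidAlgebra.induction_on with
    | zero => simp
    | add f g hf hg => rw [map_add, LinearMap.add_apply, map_add, hf, hg, add_smul]
    | single g a =>
      induction x using TensorProduct.induction_on with
      | zero => simp
      | add x y hx hy => rw [map_add, map_add, hx, hy, map_add, smul_add]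
      | tmul v x => rw [twistHom_single, h]
  exact ⟨{ e with map_smul' := key }⟩

theorem twist_smul_tmul (V : FinRep G) (E : FGProj (SkewMonoidAlgebra A G)) (g : G) (a : A)
    (v : V.carrier) (x : E.carrier) :
    (single g a : SkewMonoidAlgebra A G) • (show (twist V E).carrier from v ⊗ₜ[ℂ] x) =
      (show (twist V E).carrier from
        V.ρ g v ⊗ₜ[ℂ] ((single g a : SkewMonoidAlgebra A G) • x)) :=
  twistHom_single V.ρ E.carrier g a v x

/-- `V ⊗ E`, with the scalar structure of the tensor product, is the underlying vector space of
the twisted module. -/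
def twistComplexEquiv (V : FinRep G) (E : FGProj (SkewMonoidAlgebra A G)) :
    V.carrier ⊗[ℂ] E.carrier ≃ₗ[ℂ] (twist V E).carrier where
  __ := AddEquiv.refl (V.carrier ⊗[ℂ] E.carrier)
  map_smul' c x :=
    (LinearMap.congr_fun ((twistHom A V.ρ E.carrier).commutes c) x).symm

instance : SMul (RepClass G) (ProjClass (SkewMonoidAlgebra A G)) where
  smul := Quotient.map₂ twist fun V V' ⟨e⟩ E E' ⟨f⟩ =>
    twist_equiv (V := V) (E := E) (F := twist V' E')
      (TensorProduct.congr e.toLinearEquiv (f.restrictScalars ℂ)).toAddEquiv fun g a v x => by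
      refine Eq.trans ?_ (twist_smul_tmul V' E' g a (e v) (f x)).symm
      exact congrArg₂ (· ⊗ₜ[ℂ] ·)
        (Representation.IntertwiningMap.isIntertwining _ _ e.toIntertwiningMap g v)
        (f.map_smul _ x)

/-- Isomorphism classes of finitely generated projective modules over the crossed product form a
semimodule over the semiring of isomorphism classes of representations. -/
instance : Module (RepClass G) (ProjClass (SkewMonoidAlgebra A G)) where
  one_smul b := by
    induction b using Quotient.inductionOn with | _ E
    refine Quotient.sound (twist_equiv (V := ⟨ℂ, .trivial ℂ G ℂ⟩) (E := E) (F := E)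
      (TensorProduct.lid ℂ E.carrier).toAddEquiv fun g a v x => ?_)
    exact (smul_comm (single g a : SkewMonoidAlgebra A G) v x).symm
  mul_smul r s b := by
    induction r using Quotient.inductionOn with | _ V
    induction s using Quotient.inductionOn with | _ W
    induction b using Quotient.inductionOn with | _ E
    refine Quotient.sound (twist_equiv (V := V.tensor W) (E := E) (F := twist V (twist W E))
      ((TensorProduct.assoc ℂ V.carrier W.carrier E.carrier).trans
        (TensorProduct.congr (.refl ℂ V.carrier) (twistComplexEquiv W E))).toAddEquiv
      fun g a t x => ?_)
    generalize he : ((TensorProduct.assoc ℂ V.carrier W.carrier E.carrier).trans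
        (TensorProduct.congr (.refl ℂ V.carrier) (twistComplexEquiv W E))).toAddEquiv = e
    have hlin : ∀ t : V.carrier ⊗[ℂ] W.carrier,
        e ((V.ρ.tprod W.ρ) g t ⊗ₜ[ℂ] ((single g a : SkewMonoidAlgebra A G) • x)) =
          (show (twist V (twist W E)).carrier from
            (single g a : SkewMonoidAlgebra A G) •
              (show (twist V (twist W E)).carrier from e (t ⊗ₜ[ℂ] x))) := by
      intro t
      induction t using TensorProduct.induction_on with
      | zero =>
        rw [map_zero, TensorProduct.zero_tmul, TensorProduct.zero_tmul, map_zero]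
        exact (smul_zero (A := (twist V (twist W E)).carrier) _).symm
      | add x y hx hy =>
        rw [map_add, TensorProduct.add_tmul, TensorProduct.add_tmul, map_add, map_add, hx, hy]
        exact (smul_add (A := (twist V (twist W E)).carrier) _ _ _).symm
      | tmul v w =>
        subst he
        refine Eq.trans ?_ (twist_smul_tmul V (twist W E) g a v (w ⊗ₜ[ℂ] x)).symm
        exact congrArg (V.ρ g v ⊗ₜ[ℂ] ·) (twist_smul_tmul W E g a w x).symm
    exact hlin t
  smul_zero r := by
    induction r using Quotient.inductionOn with | _ V
    have : Subsingleton (FGProj.zero (R := SkewMonoidAlgebra A G)).carrier :=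
      inferInstanceAs (Subsingleton PUnit)
    have : Subsingleton (V.carrier ⊗[ℂ] (FGProj.zero (R := SkewMonoidAlgebra A G)).carrier) :=
      inferInstance
    refine Quotient.sound (twist_equiv (V := V) (E := FGProj.zero) (F := FGProj.zero)
      { toFun := fun _ => 0, invFun := fun _ => 0, left_inv := fun _ => Subsingleton.elim _ _,
        right_inv := fun _ => Subsingleton.elim _ _,
        map_add' := fun _ _ => Subsingleton.elim _ _ } fun g a v x => Subsingleton.elim _ _)
  smul_add r b c := by
    induction r using Quotient.inductionOn with | _ V
    induction b using Quotient.inductionOn with | _ E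
    induction c using Quotient.inductionOn with | _ F
    refine Quotient.sound (twist_equiv (V := V) (E := E.sum F) (F := (twist V E).sum (twist V F))
      (TensorProduct.prodRight ℂ ℂ V.carrier E.carrier F.carrier).toAddEquiv fun g a v x => ?_)
    exact (Prod.ext (twist_smul_tmul V E g a v x.1) (twist_smul_tmul V F g a v x.2)).symm
  add_smul r s b := by
    induction r using Quotient.inductionOn with | _ V
    induction s using Quotient.inductionOn with | _ W
    induction b using Quotient.inductionOn with | _ E
    refine Quotient.sound (twist_equiv (V := V.sum W) (E := E) (F := (twist V E).sum (twist W E))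
      (TensorProduct.prodLeft ℂ ℂ V.carrier W.carrier E.carrier).toAddEquiv fun g a v x => ?_)
    exact (Prod.ext (twist_smul_tmul V E g a v.1 x) (twist_smul_tmul W E g a v.2 x)).symm
  zero_smul b := by
    induction b using Quotient.inductionOn with | _ E
    have : Subsingleton (FGProj.zero (R := SkewMonoidAlgebra A G)).carrier :=
      inferInstanceAs (Subsingleton PUnit)
    have : Subsingleton (PUnit.{1} ⊗[ℂ] E.carrier) := inferInstance
    refine Quotient.sound (twist_equiv (V := ⟨PUnit, .trivial ℂ G PUnit⟩) (E := E)
      (F := FGProj.zero)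
      { toFun := fun _ => 0, invFun := fun _ => 0, left_inv := fun _ => Subsingleton.elim _ _,
        right_inv := fun _ => Subsingleton.elim _ _,
        map_add' := fun _ _ => Subsingleton.elim _ _ } fun g a v x => Subsingleton.elim _ _)

/-- `K₀` of the crossed product as a module over the representation ring: the class of `V` acts on
the class of `E` as the class of `V ⊗ E`. -/
instance crossedK0Module : Module (RepRing G) (K0 (SkewMonoidAlgebra A G)) :=
  grothModule (RepClass G) (ProjClass (SkewMonoidAlgebra A G))

/-- `K₀ ⊗ ℚ` as a module over `R(G) ⊗ ℚ`, with `(r ⊗ p) • (x ⊗ q) = (r • x) ⊗ (p q)`. -/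
instance crossedK0RatModule :
    Module (RepRing G ⊗[ℤ] ℚ) (K0 (SkewMonoidAlgebra A G) ⊗[ℤ] ℚ) :=
  Module.compHom _ ((Module.endTensorEndAlgHom (R := ℤ) (S := ℤ) (A := ℤ)
    (M := K0 (SkewMonoidAlgebra A G)) (N := ℚ)).comp
    (Algebra.TensorProduct.map (Algebra.lsmul ℤ ℤ (K0 (SkewMonoidAlgebra A G)))
      (Algebra.lsmul ℤ ℤ ℚ))).toRingHom

end Crossed

/-! ### Actions of a finite group on a matrix algebra -/

section MatrixAction

variable (G : Type u) [Group G] (n : ℕ) [MulSemiringAction G (Matrix (Fin n) (Fin n) ℂ)]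

/-- The crossed product `G ⋉ M_n(ℂ)`: formal sums `∑ a_g g` with `(a g) (b h) = a g(b) (g h)`. -/
abbrev CrossedProduct : Type u := SkewMonoidAlgebra (Matrix (Fin n) (Fin n) ℂ) G

instance matrixContinuousConstSMul [SMulCommClass G ℂ (Matrix (Fin n) (Fin n) ℂ)] :
    ContinuousConstSMul G (Matrix (Fin n) (Fin n) ℂ) where
  continuous_const_smul g :=
    (DistribSMul.toLinearMap ℂ (Matrix (Fin n) (Fin n) ℂ) g).continuous_of_finiteDimensional

instance crossedProductTopologicalRing [Finite G]
    [SMulCommClass G ℂ (Matrix (Fin n) (Fin n) ℂ)] : IsTopologicalRing (CrossedProduct G n) :=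
  crossed_isTopologicalRing

/-- The pull-back `G̃` of `SL_n(ℂ) → PGL_n(ℂ) = Aut(M_n(ℂ))` along the action of `G`: pairs
`(g, u)` such that `g` acts on `M_n(ℂ)` as conjugation by `u`. If `G` acts by `*`-automorphisms,
i.e. through `PU(n)`, such a `u` lies in `SU(n)`. -/
def centralExtension : Subgroup (G × Matrix.SpecialLinearGroup (Fin n) ℂ) where
  carrier := {p | ∀ a : Matrix (Fin n) (Fin n) ℂ,
    p.1 • a = (p.2 : Matrix (Fin n) (Fin n) ℂ) * a * ((p.2⁻¹ :) : Matrix (Fin n) (Fin n) ℂ)}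
  one_mem' a := by simp
  mul_mem' {p q} hp hq a := by
    rw [Prod.fst_mul, mul_smul, hq, hp, Prod.snd_mul, mul_inv_rev,
      Matrix.SpecialLinearGroup.coe_mul, Matrix.SpecialLinearGroup.coe_mul]
    simp only [mul_assoc]
  inv_mem' {p} hp a := by
    rw [Prod.fst_inv, inv_smul_eq_iff, hp, Prod.snd_inv, inv_inv]
    have h : (p.2 : Matrix (Fin n) (Fin n) ℂ) * ((p.2⁻¹ :) : Matrix (Fin n) (Fin n) ℂ) = 1 := by
      rw [← Matrix.SpecialLinearGroup.coe_mul, mul_inv_cancel, Matrix.SpecialLinearGroup.coe_one]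
    simp only [← mul_assoc, h, one_mul]
    rw [mul_assoc, h, mul_one]

/-- The image in `G` of the center of `G̃`. -/
def centerImage : Subgroup G :=
  (Subgroup.center (centralExtension G n)).map
    ((MonoidHom.fst G (Matrix.SpecialLinearGroup (Fin n) ℂ)).comp (centralExtension G n).subtype)

end MatrixAction

end TwistedK

end

noncomputable section

namespace TwistedK

universe u v

open Algebra (GrothendieckAddGroup)

/-! ### Vanishing of the topological `K₁` of a finite-dimensional algebra -/

section UnitsConnected

/-- The line through `1` and `M` meets the singular matrices in finitely many points. -/
theorem finite_setOf_det_line_eq_zero {ι : Type*} [Fintype ι] [DecidableEq ι]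
    (M : Matrix ι ι ℂ) : {t : ℂ | (1 + t • (M - 1)).det = 0}.Finite := by
  refine ((Matrix.finite_spectrum (1 - M)).image (·⁻¹)).subset fun t ht => ?_
  have ht0 : t ≠ 0 := by
    rintro rfl
    simp at ht
  refine ⟨t⁻¹, ?_, inv_inv t⟩
  rw [spectrum.mem_iff]
  intro hu
  have h1 : algebraMap ℂ (Matrix ι ι ℂ) t⁻¹ - (1 - M) = t⁻¹ • (1 + t • (M - 1)) := by
    rw [smul_add, smul_smul, inv_mul_cancel₀ ht0, one_smul, Algebra.algebraMap_eq_smul_one]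
    abel
  have hdet : (1 + t • (M - 1)).det = 0 := ht
  rw [h1, Matrix.isUnit_iff_isUnit_det, Matrix.det_smul, hdet, mul_zero] at hu
  exact not_isUnit_zero hu

/-- In a finite-dimensional topological complex algebra every unit can be joined to `1` inside the
group of units. -/
theorem joined_one_units {C : Type*} [Ring C] [Algebra ℂ C] [Module.Finite ℂ C]
    [TopologicalSpace C] [IsTopologicalRing C] [ContinuousSMul ℂ C] (x : Cˣ) :
    Joined (1 : Cˣ) x := by
  classical
  let b := Module.finBasis ℂ C
  let L := Algebra.leftMulMatrix b
  have hLinj : Function.Injective L := Algebra.leftMulMatrix_injective b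
  let bad : Set ℂ := {t : ℂ | (1 + t • (L (x : C) - 1)).det = 0}
  have hpc : IsPathConnected badᶜ :=
    (finite_setOf_det_line_eq_zero (L (x : C))).countable.isPathConnected_compl_of_one_lt_rank
      (by rw [Complex.rank_real_complex]; exact Nat.one_lt_ofNat)
  have h0 : (0 : ℂ) ∈ badᶜ := by simp [bad]
  have h1 : (1 : ℂ) ∈ badᶜ := by
    have : IsUnit (L (x : C)) := x.isUnit.map L
    rw [Matrix.isUnit_iff_isUnit_det] at this
    simpa [bad] using this.ne_zero
  obtain ⟨γ, hγ⟩ := hpc.joinedIn 0 h0 1 h1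
  let N : unitInterval → Matrix (Fin (Module.finrank ℂ C)) (Fin (Module.finrank ℂ C)) ℂ :=
    fun s => 1 + γ s • (L (x : C) - 1)
  have hN : ∀ s, IsUnit (N s).det := fun s => isUnit_iff_ne_zero.2 (hγ s)
  have hNc : Continuous N := by fun_prop
  let X : unitInterval → C := fun s => 1 + γ s • ((x : C) - 1)
  have hX : ∀ s, L (X s) = N s := fun s => by simp [X, N]
  let Φ : Matrix (Fin (Module.finrank ℂ C)) (Fin (Module.finrank ℂ C)) ℂ →ₗ[ℂ] C :=
    b.equivFun.symm.toLinearMap ∘ₗ (Matrix.mulVecBilin ℂ ℂ).flip (b.repr 1)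
  let Y : unitInterval → C := fun s => Φ (N s)⁻¹
  have hXY : ∀ s, X s * Y s = 1 := fun s => by
    apply b.repr.injective
    apply DFunLike.coe_injective
    rw [← Algebra.leftMulMatrix_mulVec_repr]
    change (L (X s)).mulVec (b.equivFun (b.equivFun.symm _)) = _
    rw [LinearEquiv.apply_symm_apply, hX]
    change (N s).mulVec ((N s)⁻¹.mulVec (b.repr 1)) = _
    rw [Matrix.mulVec_mulVec, Matrix.mul_nonsing_inv _ (hN s), Matrix.one_mulVec]
  have hYX : ∀ s, Y s * X s = 1 := fun s => by
    apply hLinj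
    rw [map_mul, map_one, mul_eq_one_comm, ← map_mul, hXY, map_one]
  have hYc : Continuous Y := by
    refine (LinearMap.continuous_of_finiteDimensional Φ).comp ?_
    have : (fun s => (N s)⁻¹) = fun s => (N s).det⁻¹ • (N s).adjugate := by
      funext s
      rw [Matrix.inv_def, Ring.inverse_eq_inv']
    rw [this]
    exact (hNc.matrix_det.inv₀ fun s => (hN s).ne_zero).smul hNc.matrix_adjugate
  have hXc : Continuous X := by fun_prop
  refine ⟨⟨⟨fun s => ⟨X s, Y s, hXY s, hYX s⟩, Units.continuous_iff.2 ⟨hXc, hYc⟩⟩, ?_, ?_⟩⟩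
  · exact Units.ext (by simp [X])
  · exact Units.ext (by simp [X])

instance crossed_continuousSMul {G A : Type*} [Group G] [Ring A] [Algebra ℂ A]
    [TopologicalSpace A] [ContinuousSMul ℂ A] : ContinuousSMul ℂ (SkewMonoidAlgebra A G) where
  continuous_smul := by
    refine continuous_induced_rng.2 (continuous_pi fun g => ?_)
    have hc : Continuous fun f : SkewMonoidAlgebra A G => f.coeff g :=
      (continuous_apply g).comp continuous_induced_dom
    exact continuous_fst.smul (hc.comp continuous_snd)

/-- The topological `K₁` of a finite-dimensional complex algebra vanishes. -/
theorem subsingleton_K1 (R : Type u) [Ring R] [Algebra ℂ R] [Module.Finite ℂ R]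
    [TopologicalSpace R] [IsTopologicalRing R] [ContinuousSMul ℂ R] : Subsingleton (K1 R) := by
  have h : ∀ (m : ℕ) (y : PiZeroGL R m), y = 1 := fun m y => by
    induction y using QuotientGroup.induction_on with | _ x
    exact (QuotientGroup.eq_one_iff x).2 (joined_one_units x)
  refine ⟨fun x y => ?_⟩
  obtain ⟨m, x, y, rfl, rfl⟩ := DirectLimit.exists_eq_mk₂ (stabPiZero R) x y
  rw [h m x, h m y]

end UnitsConnected

/-! ### Bases of Grothendieck groups -/

/-- If a commutative monoid is generated by a family that has a dual family of additive functionals,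
the family is a basis of the Grothendieck group. -/
theorem exists_groth_basis {X M : Type*} [AddCommMonoid M] [DecidableEq X] [Finite X]
    (b : X → M) (m : X → M →+ ℕ) (hm : ∀ x y, m x (b y) = if x = y then 1 else 0)
    (hgen : AddSubmonoid.closure (Set.range b) = ⊤) :
    ∃ β : Module.Basis X ℤ (GrothendieckAddGroup M), ∀ x, β x = GrothendieckAddGroup.of (b x) := by
  have := Fintype.ofFinite X
  let F : X → GrothendieckAddGroup M →+ ℤ := fun x =>
    GrothendieckAddGroup.lift ((Nat.castAddMonoidHom ℤ).comp (m x))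
  have hF : ∀ x y, F x (GrothendieckAddGroup.of (b y)) = if x = y then 1 else 0 := fun x y => by
    rw [groth_lift_of]
    simp [hm]
  have hli : LinearIndependent ℤ fun x => GrothendieckAddGroup.of (b x) := by
    rw [Fintype.linearIndependent_iff]
    intro c hc x
    have hx := congrArg (F x) hc
    rw [map_sum, map_zero] at hx
    simp only [map_zsmul, hF] at hx
    simpa using hx
  have hsp : ⊤ ≤ Submodule.span ℤ (Set.range fun x => GrothendieckAddGroup.of (b x)) := by
    rw [top_le_iff, Submodule.eq_top_iff']
    intro y
    induction y using groth_induction with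
    | hsub y z hy hz => exact sub_mem hy hz
    | h a =>
      have ha : a ∈ AddSubmonoid.closure (Set.range b) := hgen ▸ AddSubmonoid.mem_top a
      induction ha using AddSubmonoid.closure_induction with
      | mem a ha =>
        obtain ⟨x, rfl⟩ := ha
        exact Submodule.subset_span ⟨x, rfl⟩
      | zero => rw [map_zero]; exact zero_mem _
      | add a c _ _ ha hc => rw [map_add]; exact add_mem ha hc
  exact ⟨.mk hli hsp, fun x => by rw [Module.Basis.mk_apply]⟩

/-! ### Representations of finite abelian groups -/

section Weights

variable {H : Type u} [CommGroup H]

/-- The one-dimensional representation attached to a character. -/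
def charRep (χ : H →* ℂˣ) : FinRep H where
  carrier := ℂ
  ρ := (Algebra.lsmul ℂ ℂ ℂ : ℂ →ₐ[ℂ] Module.End ℂ ℂ).toMonoidHom.comp
    ((Units.coeHom ℂ).comp χ)

/-- The isomorphism class of a representation. -/
def RepClass.mk (V : FinRep H) : RepClass H := Quotient.mk _ V

/-- The class of the one-dimensional representation attached to a character. -/
def charClass (χ : H →* ℂˣ) : RepClass H := RepClass.mk (charRep χ)

theorem charClass_mul (χ ψ : H →* ℂˣ) : charClass χ * charClass ψ = charClass (χ * ψ) := by
  refine RepClass.sound (V := (charRep χ).tensor (charRep ψ)) (W := charRep (χ * ψ))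
    (TensorProduct.lid ℂ ℂ) fun g x => ?_
  refine equivariant_of_tmul (TensorProduct.lid ℂ ℂ).toLinearMap
    (((charRep χ).tensor (charRep ψ)).ρ g) ((charRep (χ * ψ)).ρ g) (fun z w => ?_) x
  change ((χ g : ℂ) * z) * ((ψ g : ℂ) * w) = ((χ g * ψ g : ℂˣ) : ℂ) * (z * w)
  rw [Units.val_mul]
  ring

theorem charClass_one : charClass (1 : H →* ℂˣ) = 1 :=
  RepClass.sound (V := charRep 1) (W := ⟨ℂ, .trivial ℂ H ℂ⟩) (.refl ℂ ℂ)
    fun _ (z : ℂ) => one_mul z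

variable {V : Type*} [AddCommGroup V] [Module ℂ V] (ρ : Representation ℂ H V)

/-- The subspace on which `H` acts through the character `χ`. -/
def weightSpace (χ : H →* ℂˣ) : Submodule ℂ V where
  carrier := {v | ∀ h, ρ h v = (χ h : ℂ) • v}
  zero_mem' h := by simp
  add_mem' hv hw h := by rw [map_add, hv h, hw h, smul_add]
  smul_mem' c v hv h := by rw [map_smul, hv h, smul_comm]

theorem mem_weightSpace {χ : H →* ℂˣ} {v : V} :
    v ∈ weightSpace ρ χ ↔ ∀ h, ρ h v = (χ h : ℂ) • v := Iff.rfl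

variable [Finite H]

theorem sum_characters [Fintype (H →* ℂˣ)] {h : H} (hh : h ≠ 1) :
    ∑ χ : H →* ℂˣ, ((χ h : ℂˣ) : ℂ) = 0 := by
  obtain ⟨φ, hφ⟩ := CommGroup.exists_apply_ne_one_of_hasEnoughRootsOfUnity H ℂ hh
  have h1 : ((φ h : ℂˣ) : ℂ) * ∑ χ : H →* ℂˣ, ((χ h : ℂˣ) : ℂ) =
      ∑ χ : H →* ℂˣ, ((χ h : ℂˣ) : ℂ) := by
    rw [Finset.mul_sum, ← Equiv.sum_comp (Equiv.mulLeft φ) fun χ : H →* ℂˣ => ((χ h : ℂˣ) : ℂ)]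
    simp
  have h2 : ((φ h : ℂˣ) : ℂ) - 1 ≠ 0 := sub_ne_zero.2 fun h => hφ (Units.ext h)
  exact (mul_eq_zero.1 (by rw [sub_mul, h1, one_mul, sub_self] :
    (((φ h : ℂˣ) : ℂ) - 1) * ∑ χ : H →* ℂˣ, ((χ h : ℂˣ) : ℂ) = 0)).resolve_left h2

/-- The projection onto the weight space of `χ`. -/
def weightProj (χ : H →* ℂˣ) : V →ₗ[ℂ] V :=
  letI := Fintype.ofFinite H
  (Fintype.card H : ℂ)⁻¹ • ∑ h : H, ((χ h⁻¹ : ℂˣ) : ℂ) • ρ h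

theorem weightProj_apply [Fintype H] (χ : H →* ℂˣ) (v : V) :
    weightProj ρ χ v = (Fintype.card H : ℂ)⁻¹ • ∑ h : H, ((χ h⁻¹ : ℂˣ) : ℂ) • ρ h v := by
  rw [weightProj, LinearMap.smul_apply, LinearMap.sum_apply]
  simp only [LinearMap.smul_apply]
  congr!

theorem weightProj_rho (χ : H →* ℂˣ) (k : H) (v : V) :
    weightProj ρ χ (ρ k v) = (χ k : ℂ) • weightProj ρ χ v := by
  have := Fintype.ofFinite H
  rw [weightProj_apply, weightProj_apply, smul_comm ((χ k : ℂˣ) : ℂ),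
    Finset.smul_sum (r := ((χ k : ℂˣ) : ℂ)),
    ← Equiv.sum_comp (Equiv.mulRight k) fun h => ((χ k : ℂˣ) : ℂ) • ((χ h⁻¹ : ℂˣ) : ℂ) • ρ h v]
  congr 1
  refine Finset.sum_congr rfl fun h _ => ?_
  rw [Equiv.coe_mulRight, smul_smul, ← Units.val_mul, ← map_mul, map_mul ρ, Module.End.mul_apply,
    mul_inv_rev, mul_inv_cancel_left]

theorem weightProj_mem (χ : H →* ℂˣ) (v : V) : weightProj ρ χ v ∈ weightSpace ρ χ := by
  have := Fintype.ofFinite H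
  intro k
  rw [← weightProj_rho, weightProj_apply, weightProj_apply, map_smul, map_sum]
  congr 1
  refine Finset.sum_congr rfl fun h _ => ?_
  rw [map_smul, ← Module.End.mul_apply, ← Module.End.mul_apply, ← map_mul, ← map_mul, mul_comm]

theorem weightProj_of_mem {χ : H →* ℂˣ} {v : V} (hv : v ∈ weightSpace ρ χ) :
    weightProj ρ χ v = v := by
  have := Fintype.ofFinite H
  rw [weightProj_apply]
  have : ∀ h : H, ((χ h⁻¹ : ℂˣ) : ℂ) • ρ h v = v := fun h => by
    rw [hv h, smul_smul, ← Units.val_mul, ← map_mul, inv_mul_cancel, map_one, Units.val_one,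
      one_smul]
  simp only [this, Finset.sum_const, Finset.card_univ]
  rw [← Nat.cast_smul_eq_nsmul ℂ, smul_smul, inv_mul_cancel₀ (by simp), one_smul]

theorem sum_weightProj [Fintype (H →* ℂˣ)] (v : V) :
    ∑ χ : H →* ℂˣ, weightProj ρ χ v = v := by
  classical
  have := Fintype.ofFinite H
  simp only [weightProj_apply]
  rw [← Finset.smul_sum, Finset.sum_comm]
  have : ∀ h : H, ∑ χ : H →* ℂˣ, ((χ h⁻¹ : ℂˣ) : ℂ) • ρ h v =
      if h = 1 then (Fintype.card H : ℂ) • v else 0 := fun h => by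
    rw [← Finset.sum_smul]
    split_ifs with hh
    · subst hh
      have hcard := CommGroup.card_monoidHom_of_hasEnoughRootsOfUnity H ℂ
      rw [Nat.card_eq_fintype_card, Nat.card_eq_fintype_card] at hcard
      simp [hcard]
    · rw [sum_characters (inv_ne_one.2 hh), zero_smul]
  rw [Finset.sum_congr rfl fun h _ => this h, Finset.sum_ite_eq' Finset.univ (1 : H),
    if_pos (Finset.mem_univ _), smul_smul, inv_mul_cancel₀ (by simp), one_smul]

instance finite_characters : Finite (H →* ℂˣ) :=
  Nat.finite_of_card_ne_zero (by
    rw [CommGroup.card_monoidHom_of_hasEnoughRootsOfUnity H ℂ]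
    exact Nat.card_ne_zero.2 ⟨inferInstance, inferInstance⟩)

/-- A nonzero representation of a finite abelian group contains a common eigenvector. -/
theorem exists_weight_vector [Nontrivial V] : ∃ χ : H →* ℂˣ, ∃ v ∈ weightSpace ρ χ, v ≠ 0 := by
  have := Fintype.ofFinite (H →* ℂˣ)
  obtain ⟨v, hv⟩ := exists_ne (0 : V)
  by_contra! h
  refine hv ?_
  rw [← sum_weightProj ρ v]
  exact Finset.sum_eq_zero fun χ _ => h χ _ (weightProj_mem ρ χ v)

end Weights

section RepBasis

variable {H : Type u} [CommGroup H]

/-- The multiplicity of a character in a representation. -/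
def weightMult (χ : H →* ℂˣ) : RepClass H →+ ℕ where
  toFun := Quotient.lift (fun V : FinRep H => Module.finrank ℂ (weightSpace V.ρ χ)) (by
    rintro V W ⟨e⟩
    have he : ∀ h v, e (V.ρ h v) = W.ρ h (e v) :=
      Representation.IntertwiningMap.isIntertwining _ _ e.toIntertwiningMap
    refine LinearEquiv.finrank_eq (e.toLinearEquiv.ofSubmodules _ _ ?_)
    ext w
    obtain ⟨v, rfl⟩ := e.toLinearEquiv.surjective w
    rw [Submodule.map_equiv_eq_comap_symm, Submodule.mem_comap]
    simp only [LinearEquiv.coe_coe, LinearEquiv.symm_apply_apply, mem_weightSpace]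
    refine forall_congr' fun h => ?_
    have h1 : W.ρ h (e.toLinearEquiv v) = e.toLinearEquiv (V.ρ h v) := (he h v).symm
    rw [h1, ← map_smul, e.toLinearEquiv.injective.eq_iff])
  map_zero' := by
    change Module.finrank ℂ (weightSpace (Representation.trivial ℂ H PUnit.{1}) χ) = 0
    exact Module.finrank_zero_of_subsingleton
  map_add' a b := by
    induction a using Quotient.inductionOn with | _ V
    induction b using Quotient.inductionOn with | _ W
    change Module.finrank ℂ (weightSpace (V.ρ.prod W.ρ) χ) =
      Module.finrank ℂ (weightSpace V.ρ χ) + Module.finrank ℂ (weightSpace W.ρ χ)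
    rw [← Module.finrank_prod]
    have h : weightSpace (V.ρ.prod W.ρ) χ = (weightSpace V.ρ χ).prod (weightSpace W.ρ χ) := by
      ext x
      simp only [mem_weightSpace, Submodule.mem_prod, ← forall_and]
      exact forall_congr' fun h => Prod.ext_iff
    rw [h]
    exact LinearEquiv.finrank_eq
      { toFun := fun x => (⟨x.1.1, x.2.1⟩, ⟨x.1.2, x.2.2⟩)
        invFun := fun x => ⟨(x.1, x.2), x.1.2, x.2.2⟩
        map_add' := fun _ _ => rfl
        map_smul' := fun _ _ => rfl }

theorem weightMult_charClass [DecidableEq (H →* ℂˣ)] (χ ψ : H →* ℂˣ) :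
    weightMult χ (charClass ψ) = if χ = ψ then 1 else 0 := by
  change Module.finrank ℂ (weightSpace (charRep ψ).ρ χ) = _
  split_ifs with h
  · subst h
    have : weightSpace (charRep χ).ρ χ = ⊤ := by
      rw [eq_top_iff]
      exact fun z _ h => rfl
    rw [this, finrank_top]
    exact Module.finrank_self ℂ
  · have : weightSpace (charRep ψ).ρ χ = ⊥ := by
      rw [eq_bot_iff]
      intro (z : ℂ) hz
      by_contra hz0
      refine h (MonoidHom.ext fun k => Units.ext ?_)
      have hk : (ψ k : ℂ) * z = (χ k : ℂ) * z := hz k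
      have hz1 : z ≠ (0 : ℂ) := hz0
      exact (mul_right_cancel₀ hz1 hk).symm
    rw [this, finrank_bot]

variable [Finite H]

theorem closure_charClass :
    AddSubmonoid.closure (Set.range (charClass (H := H))) = ⊤ := by
  suffices h : ∀ (d : ℕ) (V : FinRep H), Module.finrank ℂ V.carrier = d →
      RepClass.mk V ∈ AddSubmonoid.closure (Set.range (charClass (H := H))) by
    rw [eq_top_iff]
    intro a _
    induction a using Quotient.inductionOn with | _ V
    exact h _ V rfl
  intro d
  induction d using Nat.strong_induction_on with | _ d ih
  intro V hV
  rcases subsingleton_or_nontrivial V.carrier with hs | hs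
  · have : RepClass.mk V = 0 :=
      RepClass.sound (V := V) (W := ⟨PUnit, .trivial ℂ H PUnit⟩)
        (LinearEquiv.ofSubsingleton V.carrier PUnit.{1}) fun g x => Subsingleton.elim (α := PUnit) _ _
    rw [this]
    exact zero_mem _
  obtain ⟨χ, v, hv, hv0⟩ := exists_weight_vector V.ρ
  obtain ⟨l, hl⟩ := Module.Projective.exists_dual_ne_zero ℂ hv0
  let q : V.carrier →ₗ[ℂ] ℂ := (l v)⁻¹ • l ∘ₗ weightProj V.ρ χ
  have hqv : q v = 1 := by
    simp only [q, LinearMap.smul_apply, LinearMap.comp_apply, weightProj_of_mem V.ρ hv, smul_eq_mul]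
    exact inv_mul_cancel₀ hl
  have hq : ∀ h x, q (V.ρ h x) = (χ h : ℂ) * q x := fun h x => by
    simp only [q, LinearMap.smul_apply, LinearMap.comp_apply, weightProj_rho, map_smul, smul_eq_mul]
    ring
  have hmaps : ∀ h, ∀ x ∈ LinearMap.ker q, V.ρ h x ∈ LinearMap.ker q := fun h x hx => by
    rw [LinearMap.mem_ker, hq, LinearMap.mem_ker.1 hx, mul_zero]
  let W : FinRep H :=
    { carrier := LinearMap.ker q
      ρ :=
        { toFun := fun h => (V.ρ h).restrict (hmaps h)
          map_one' := by ext x; simp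
          map_mul' := fun g h => by ext x; simp } }
  let e : V.carrier ≃ₗ[ℂ] ℂ × LinearMap.ker q := LinearEquiv.ofLinearMap
    (q.prod ((LinearMap.id - q.smulRight v).codRestrict (LinearMap.ker q) fun x => by
      simp [hqv]))
    ((LinearMap.toSpanSingleton ℂ V.carrier v).coprod (LinearMap.ker q).subtype)
    (by
      refine LinearMap.ext fun x => Prod.ext ?_ (Subtype.ext ?_)
      · simp [hqv]
      · simp [hqv])
    (by ext x; simp)
  have hVW : RepClass.mk V = charClass χ + RepClass.mk W := by
    refine RepClass.sound (V := V) (W := (charRep χ).sum W) e fun g x => ?_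
    refine Prod.ext (hq g x) (Subtype.ext ?_)
    change V.ρ g x - q (V.ρ g x) • v = V.ρ g (x - q x • v)
    rw [hq, map_sub, map_smul, hv g, smul_smul, mul_comm]
  have hfin : Module.finrank ℂ W.carrier < d := by
    have := e.finrank_eq
    rw [Module.finrank_prod, Module.finrank_self, hV] at this
    change Module.finrank ℂ (LinearMap.ker q) < d
    omega
  rw [hVW]
  exact add_mem (AddSubmonoid.subset_closure ⟨χ, rfl⟩) (ih _ hfin W rfl)

variable (H) in
/-- The characters form a basis of the representation ring of a finite abelian group. -/
theorem exists_repRing_basis : ∃ β : Module.Basis (H →* ℂˣ) ℤ (RepRing H),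
    ∀ χ, β χ = GrothendieckAddGroup.of (charClass χ) := by
  classical
  exact exists_groth_basis charClass weightMult weightMult_charClass closure_charClass

variable (H) in
/-- The rationalized representation ring of a finite abelian group is isomorphic to its rational
group algebra. -/
theorem nonempty_repRing_rat_equiv :
    Nonempty (RepRing H ⊗[ℤ] ℚ ≃+* MonoidAlgebra ℚ H) := by
  obtain ⟨β, hβ⟩ := exists_repRing_basis H
  obtain ⟨d⟩ := CommGroup.monoidHom_mulEquiv_of_hasEnoughRootsOfUnity H ℂ
  let c : H →* RepRing H :=
    { toFun := fun h => GrothendieckAddGroup.of (charClass (d.symm h))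
      map_one' := by rw [map_one, charClass_one]; rfl
      map_mul' := fun g h => by
        rw [map_mul, ← charClass_mul]
        exact (grothAct_of_of (S := RepClass H) (M := RepClass H) _ _).symm }
  let Φ : MonoidAlgebra ℚ H →ₐ[ℚ] ℚ ⊗[ℤ] RepRing H :=
    MonoidAlgebra.lift ℚ (ℚ ⊗[ℤ] RepRing H) H
      (((Algebra.TensorProduct.includeRight : RepRing H →ₐ[ℤ] ℚ ⊗[ℤ] RepRing H) :
        RepRing H →* ℚ ⊗[ℤ] RepRing H).comp c)
  let γ : Module.Basis H ℚ (ℚ ⊗[ℤ] RepRing H) := (β.baseChange ℚ).reindex d.toEquiv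
  have hΦ : Φ.toLinearMap = ((MonoidAlgebra.basis H ℚ).equiv γ (.refl H)).toLinearMap := by
    refine (MonoidAlgebra.basis H ℚ).ext fun h => ?_
    rw [LinearEquiv.coe_coe, Module.Basis.equiv_apply (MonoidAlgebra.basis H ℚ)]
    simp [Φ, γ, c, hβ]
  have hbij : Function.Bijective Φ := by
    have : ⇑Φ = ((MonoidAlgebra.basis H ℚ).equiv γ (.refl H)) :=
      congrArg DFunLike.coe hΦ
    rw [this]
    exact LinearEquiv.bijective _
  exact ⟨(Algebra.TensorProduct.comm ℤ (RepRing H) ℚ).toRingEquiv.trans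
    (RingEquiv.ofBijective Φ hbij).symm⟩

end RepBasis

open SkewMonoidAlgebra

/-! ### Simple modules over crossed products by finite abelian groups -/

/-- Two nonzero modules over a simple Artinian ring are related by a nonzero homomorphism. -/
theorem exists_linearMap_ne_zero_of_isSimpleRing {A : Type*} [Ring A] [IsSimpleRing A]
    [IsArtinianRing A] (E F : Type*) [AddCommGroup E] [AddCommGroup F] [Module A E] [Module A F]
    [Nontrivial E] [Nontrivial F] : ∃ f : E →ₗ[A] F, f ≠ 0 := by
  obtain ⟨S, hS⟩ := IsSemisimpleModule.exists_simple_submodule A E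
  obtain ⟨T, hT⟩ := IsSemisimpleModule.exists_simple_submodule A F
  obtain ⟨I, ⟨e⟩⟩ := IsSemisimpleRing.exists_linearEquiv_ideal_of_isSimpleModule A S
  obtain ⟨J, ⟨e'⟩⟩ := IsSemisimpleRing.exists_linearEquiv_ideal_of_isSimpleModule A T
  have := IsSimpleModule.congr e.symm
  have := IsSimpleModule.congr e'.symm
  obtain ⟨d⟩ := IsSimpleRing.isIsotypic A A J I
  obtain ⟨S', hS'⟩ := exists_isCompl S
  let p : E →ₗ[A] S := S.projectionOnto S' hS'
  let j : S →ₗ[A] F := T.subtype ∘ₗ (e.trans (d.trans e'.symm)).toLinearMap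
  have hj : Function.Injective j :=
    T.subtype_injective.comp (e.trans (d.trans e'.symm)).injective
  have := IsSimpleModule.nontrivial A S
  obtain ⟨s, hs⟩ := exists_ne (0 : S)
  refine ⟨j ∘ₗ p, fun h => hs (hj ?_)⟩
  have hsp : p s = s := Submodule.projectionOnto_apply_left hS' s
  rw [map_zero, ← hsp]
  exact LinearMap.congr_fun h (s : E)

/-- The isomorphism class of a finitely generated projective module. -/
def ProjClass.mk {R : Type u} [Ring R] (E : FGProj R) : ProjClass R := Quotient.mk _ E

theorem ProjClass.mk_eq_mk {R : Type u} [Ring R] {E F : FGProj R} :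
    ProjClass.mk E = ProjClass.mk F ↔ Nonempty (E.carrier ≃ₗ[R] F.carrier) :=
  Quotient.eq (r := FGProj.setoid R)

section CrossedAbelian

variable {G : Type u} [CommGroup G] {A : Type v} [Ring A] [Algebra ℂ A] [MulSemiringAction G A]
  [SMulCommClass G ℂ A]

theorem crossed_isSemisimpleRing [Finite G] [IsSemisimpleRing A] :
    IsSemisimpleRing (SkewMonoidAlgebra A G) := by
  refine (isSemisimpleModule_iff _ _).2 ⟨fun m => ?_⟩
  obtain ⟨T, hT⟩ := crossed_split m.mkQ m.mkQ_surjective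
  have hT' : ∀ y, m.mkQ (T y) = y := LinearMap.congr_fun hT
  refine ⟨LinearMap.range T, ?_, ?_⟩
  · rw [Submodule.disjoint_def]
    rintro _ hx ⟨y, rfl⟩
    have : y = 0 := by rw [← hT' y, Submodule.mkQ_apply, Submodule.Quotient.mk_eq_zero]; exact hx
    rw [this, map_zero]
  · rw [codisjoint_iff, Submodule.eq_top_iff']
    intro x
    refine Submodule.mem_sup.2 ⟨x - T (m.mkQ x), ?_, T (m.mkQ x), ⟨_, rfl⟩, sub_add_cancel _ _⟩
    rw [← Submodule.Quotient.mk_eq_zero, ← Submodule.mkQ_apply, map_sub, hT', sub_self]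

/-- A linear map of modules over the crossed product is `χ`-semilinear if it becomes a homomorphism
after the source is tensored with the character `χ`. -/
def IsTwisted (χ : G →* ℂˣ) {E F : FGProj (SkewMonoidAlgebra A G)}
    (f : E.carrier →ₗ[ℂ] F.carrier) : Prop :=
  ∀ (g : G) (a : A) (x : E.carrier),
    (χ g : ℂ) • f ((single g a : SkewMonoidAlgebra A G) • x) =
      (single g a : SkewMonoidAlgebra A G) • f x

variable {χ : G →* ℂˣ} {E F : FGProj (SkewMonoidAlgebra A G)} {f : E.carrier →ₗ[ℂ] F.carrier}

theorem IsTwisted.exists_smul_apply (hf : IsTwisted χ f) (b : SkewMonoidAlgebra A G) :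
    ∃ b' : SkewMonoidAlgebra A G, ∀ x, b' • f x = f (b • x) := by
  induction b using SkewMonoidAlgebra.induction_on with
  | zero => exact ⟨0, fun x => by rw [zero_smul, zero_smul, map_zero]⟩
  | add b c hb hc =>
    obtain ⟨b', hb⟩ := hb
    obtain ⟨c', hc⟩ := hc
    exact ⟨b' + c', fun x => by rw [add_smul, add_smul, map_add, hb, hc]⟩
  | single g a =>
    refine ⟨((χ g)⁻¹ : ℂˣ).val • single g a, fun x => ?_⟩
    rw [smul_assoc, ← hf g a x, smul_smul, ← Units.val_mul, inv_mul_cancel, Units.val_one,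
      one_smul]

theorem IsTwisted.exists_apply_smul (hf : IsTwisted χ f) (b : SkewMonoidAlgebra A G) :
    ∃ b' : SkewMonoidAlgebra A G, ∀ x, f (b' • x) = b • f x := by
  induction b using SkewMonoidAlgebra.induction_on with
  | zero => exact ⟨0, fun x => by rw [zero_smul, zero_smul, map_zero]⟩
  | add b c hb hc =>
    obtain ⟨b', hb⟩ := hb
    obtain ⟨c', hc⟩ := hc
    exact ⟨b' + c', fun x => by rw [add_smul, add_smul, map_add, hb, hc]⟩
  | single g a =>
    refine ⟨(χ g : ℂ) • single g a, fun x => ?_⟩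
    rw [smul_assoc, map_smul, hf g a x]

theorem IsTwisted.bijective_of_ne_zero (hf : IsTwisted χ f)
    [IsSimpleModule (SkewMonoidAlgebra A G) E.carrier]
    [IsSimpleModule (SkewMonoidAlgebra A G) F.carrier] (h0 : f ≠ 0) : Function.Bijective f := by
  constructor
  · rw [injective_iff_map_eq_zero]
    intro x hx
    by_contra hx0
    refine h0 (LinearMap.ext fun y => ?_)
    obtain ⟨b, rfl⟩ := IsSimpleModule.toSpanSingleton_surjective (SkewMonoidAlgebra A G) hx0 y
    obtain ⟨b', hb⟩ := hf.exists_smul_apply b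
    rw [LinearMap.toSpanSingleton_apply, ← hb, hx, smul_zero, LinearMap.zero_apply]
  · obtain ⟨x, hx⟩ := DFunLike.ne_iff.1 h0
    intro z
    obtain ⟨b, rfl⟩ := IsSimpleModule.toSpanSingleton_surjective (SkewMonoidAlgebra A G) hx z
    obtain ⟨b', hb⟩ := hf.exists_apply_smul b
    exact ⟨b' • x, hb x⟩

theorem IsTwisted.isSimpleModule (hf : IsTwisted χ f) (hbij : Function.Bijective f)
    [IsSimpleModule (SkewMonoidAlgebra A G) E.carrier] :
    IsSimpleModule (SkewMonoidAlgebra A G) F.carrier := by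
  rw [isSimpleModule_iff_toSpanSingleton_surjective]
  have := IsSimpleModule.nontrivial (SkewMonoidAlgebra A G) E.carrier
  refine ⟨hbij.1.nontrivial, fun y hy z => ?_⟩
  obtain ⟨x, rfl⟩ := hbij.2 y
  obtain ⟨w, rfl⟩ := hbij.2 z
  have hx : x ≠ 0 := fun h => hy (by rw [h, map_zero])
  obtain ⟨b, rfl⟩ := IsSimpleModule.toSpanSingleton_surjective (SkewMonoidAlgebra A G) hx w
  obtain ⟨b', hb⟩ := hf.exists_smul_apply b
  exact ⟨b', hb x⟩

variable [Finite G] [Module.Finite ℂ A] [IsSemisimpleRing A]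

theorem charClass_smul_eq_of_isTwisted (hf : IsTwisted χ f) (hbij : Function.Bijective f) :
    charClass χ • ProjClass.mk E = ProjClass.mk F := by
  refine Quotient.sound (twist_equiv (V := charRep χ) (E := E) (F := F)
    ((TensorProduct.lid ℂ E.carrier).trans (LinearEquiv.ofBijective f hbij)).toAddEquiv
    fun g a (z : ℂ) x => ?_)
  change f (((χ g : ℂ) * z) • ((single g a : SkewMonoidAlgebra A G) • x)) =
    (single g a : SkewMonoidAlgebra A G) • f (z • x)
  rw [f.map_smul, f.map_smul, smul_comm _ z, ← hf g a x, smul_smul, mul_comm]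

/-- The tautological map from a module to its tensor product with a character. -/
theorem exists_isTwisted_twist (χ : G →* ℂˣ) (E : FGProj (SkewMonoidAlgebra A G)) :
    ∃ f : E.carrier →ₗ[ℂ] (twist (charRep χ) E).carrier,
      IsTwisted χ f ∧ Function.Bijective f := by
  let e : E.carrier ≃ₗ[ℂ] (twist (charRep χ) E).carrier :=
    (TensorProduct.lid ℂ E.carrier).symm.trans (twistComplexEquiv (charRep χ) E)
  refine ⟨e.toLinearMap, fun g a x => ?_, e.bijective⟩
  refine Eq.trans ?_ (twist_smul_tmul (charRep χ) E g a (1 : ℂ) x).symm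
  rw [← map_smul]
  change (1 : ℂ) ⊗ₜ[ℂ] ((χ g : ℂ) • ((single g a : SkewMonoidAlgebra A G) • x)) =
    ((χ g : ℂ) * 1) ⊗ₜ[ℂ] ((single g a : SkewMonoidAlgebra A G) • x)
  rw [← TensorProduct.smul_tmul, smul_eq_mul]

theorem exists_isTwisted_of_charClass_smul_eq
    (h : charClass χ • ProjClass.mk E = ProjClass.mk F) :
    ∃ f : E.carrier →ₗ[ℂ] F.carrier, IsTwisted χ f ∧ Function.Bijective f := by
  obtain ⟨e⟩ : Nonempty ((twist (charRep χ) E).carrier ≃ₗ[SkewMonoidAlgebra A G] F.carrier) :=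
    ProjClass.mk_eq_mk.1 h
  obtain ⟨f, hf, hbij⟩ := exists_isTwisted_twist χ E
  refine ⟨(e.toLinearMap.restrictScalars ℂ) ∘ₗ f, fun g a x => ?_, e.bijective.comp hbij⟩
  rw [← map_smul, LinearMap.comp_apply, LinearMap.comp_apply, map_smul, hf g a x]
  exact e.map_smul _ _

theorem isSimpleModule_twist (χ : G →* ℂˣ) (E : FGProj (SkewMonoidAlgebra A G))
    [IsSimpleModule (SkewMonoidAlgebra A G) E.carrier] :
    IsSimpleModule (SkewMonoidAlgebra A G) (twist (charRep χ) E).carrier := by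
  obtain ⟨f, hf, hbij⟩ := exists_isTwisted_twist χ E
  exact hf.isSimpleModule hbij

/-- The `A`-linear maps between two modules over the crossed product. -/
def coeffHom (E F : FGProj (SkewMonoidAlgebra A G)) : Submodule ℂ (E.carrier →ₗ[ℂ] F.carrier) where
  carrier := {f | ∀ (a : A) x, f ((single 1 a : SkewMonoidAlgebra A G) • x) =
    (single 1 a : SkewMonoidAlgebra A G) • f x}
  zero_mem' a x := by simp
  add_mem' hf hg a x := by rw [LinearMap.add_apply, hf, hg, LinearMap.add_apply, smul_add]
  smul_mem' c f hf a x := by rw [LinearMap.smul_apply, hf, LinearMap.smul_apply, smul_comm]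

/-- The group `G` acts by conjugation on the `A`-linear maps between two modules over the crossed
product. -/
def coeffHomRep (E F : FGProj (SkewMonoidAlgebra A G)) : Representation ℂ G (coeffHom E F) where
  toFun g :=
    { toFun := fun f => ⟨Algebra.lsmul ℂ ℂ F.carrier (single g 1 : SkewMonoidAlgebra A G) ∘ₗ f.1 ∘ₗ
        Algebra.lsmul ℂ ℂ E.carrier (single g⁻¹ 1 : SkewMonoidAlgebra A G), fun a x => by
          change (single g 1 : SkewMonoidAlgebra A G) • f.1 ((single g⁻¹ 1 : SkewMonoidAlgebra A G) •
            (single 1 a : SkewMonoidAlgebra A G) • x) = (single 1 a : SkewMonoidAlgebra A G) •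
            (single g 1 : SkewMonoidAlgebra A G) •
              f.1 ((single g⁻¹ 1 : SkewMonoidAlgebra A G) • x)
          have h1 : (single g⁻¹ 1 : SkewMonoidAlgebra A G) * single 1 a =
            single 1 (g⁻¹ • a) * single g⁻¹ 1 := by simp
          have h2 : (single g 1 : SkewMonoidAlgebra A G) * single 1 (g⁻¹ • a) =
            single 1 a * single g 1 := by simp
          rw [smul_smul, h1, mul_smul, f.2, smul_smul, h2, mul_smul]⟩
      map_add' := fun f f' => Subtype.ext (LinearMap.ext fun x => smul_add _ _ _)
      map_smul' := fun c f => Subtype.ext (LinearMap.ext fun x =>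
        smul_comm (single g 1 : SkewMonoidAlgebra A G) c _) }
  map_one' := by
    refine LinearMap.ext fun f => Subtype.ext (LinearMap.ext fun x => ?_)
    change (single 1 1 : SkewMonoidAlgebra A G) •
      f.1 ((single 1⁻¹ 1 : SkewMonoidAlgebra A G) • x) = f.1 x
    rw [inv_one, single_one_one, one_smul, one_smul]
  map_mul' g h := by
    refine LinearMap.ext fun f => Subtype.ext (LinearMap.ext fun x => ?_)
    change (single (g * h) 1 : SkewMonoidAlgebra A G) •
      f.1 ((single (g * h)⁻¹ 1 : SkewMonoidAlgebra A G) • x) =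
      (single g 1 : SkewMonoidAlgebra A G) • (single h 1 : SkewMonoidAlgebra A G) •
        f.1 ((single h⁻¹ 1 : SkewMonoidAlgebra A G) •
          (single g⁻¹ 1 : SkewMonoidAlgebra A G) • x)
    rw [smul_smul, smul_smul]
    simp

/-- Over the crossed product with a simple algebra, any two simple modules differ by a character. -/
theorem exists_charClass_smul_eq [IsSimpleRing A] (E F : FGProj (SkewMonoidAlgebra A G))
    [IsSimpleModule (SkewMonoidAlgebra A G) E.carrier]
    [IsSimpleModule (SkewMonoidAlgebra A G) F.carrier] :
    ∃ χ : G →* ℂˣ, charClass χ • ProjClass.mk E = ProjClass.mk F := by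
  have := IsSimpleModule.nontrivial (SkewMonoidAlgebra A G) E.carrier
  have := IsSimpleModule.nontrivial (SkewMonoidAlgebra A G) F.carrier
  have := IsArtinianRing.of_finite ℂ A
  have : Nontrivial (coeffHom E F) := by
    let : Module A E.carrier := Module.compHom E.carrier (singleOneRingHom : A →+* SkewMonoidAlgebra A G)
    let : Module A F.carrier := Module.compHom F.carrier (singleOneRingHom : A →+* SkewMonoidAlgebra A G)
    have hE : ∀ (a : A) (x : E.carrier), a • x = (single 1 a : SkewMonoidAlgebra A G) • x :=
      fun _ _ => rfl
    have hF : ∀ (a : A) (x : F.carrier), a • x = (single 1 a : SkewMonoidAlgebra A G) • x :=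
      fun _ _ => rfl
    have : IsScalarTower ℂ A E.carrier := ⟨fun c a x => by
      rw [hE, hE, ← smul_single, smul_assoc]⟩
    have : IsScalarTower ℂ A F.carrier := ⟨fun c a x => by
      rw [hF, hF, ← smul_single, smul_assoc]⟩
    obtain ⟨f, hf⟩ := exists_linearMap_ne_zero_of_isSimpleRing (A := A) E.carrier F.carrier
    refine ⟨⟨⟨f.restrictScalars ℂ, fun a x => f.map_smul a x⟩, 0, fun h => hf ?_⟩⟩
    exact LinearMap.ext fun x => LinearMap.congr_fun (congrArg Subtype.val h) x
  obtain ⟨χ, f, hf, hf0⟩ := exists_weight_vector (coeffHomRep E F)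
  have hfg : ∀ (g : G) x, (single g 1 : SkewMonoidAlgebra A G) •
      f.1 ((single g⁻¹ 1 : SkewMonoidAlgebra A G) • x) = (χ g : ℂ) • f.1 x := fun g x =>
    LinearMap.congr_fun (congrArg Subtype.val (hf g)) x
  have htw : IsTwisted χ f.1 := fun g a x => by
    have h1 : (single g⁻¹ 1 : SkewMonoidAlgebra A G) * single g 1 = 1 := by
      rw [single_mul_single]; simp
    have h2 : (single g a : SkewMonoidAlgebra A G) = single 1 a * single g 1 := by simp
    rw [h2, mul_smul, f.2, smul_comm, ← hfg, smul_smul (single g⁻¹ 1), h1, one_smul,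
      mul_smul]
  exact ⟨χ, charClass_smul_eq_of_isTwisted htw
    (htw.bijective_of_ne_zero fun h => hf0 (Subtype.ext h))⟩

end CrossedAbelian

/-! ### The central extension and the stabilizer of a simple module -/

section MatrixPairing

variable {G : Type u} [CommGroup G] {n : ℕ} [MulSemiringAction G (Matrix (Fin n) (Fin n) ℂ)]

theorem coe_mul_coe_inv (u : Matrix.SpecialLinearGroup (Fin n) ℂ) :
    (u : Matrix (Fin n) (Fin n) ℂ) * ((u⁻¹ :) : Matrix (Fin n) (Fin n) ℂ) = 1 := by
  rw [← Matrix.SpecialLinearGroup.coe_mul, mul_inv_cancel, Matrix.SpecialLinearGroup.coe_one]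

theorem coe_inv_mul_coe (u : Matrix.SpecialLinearGroup (Fin n) ℂ) :
    ((u⁻¹ :) : Matrix (Fin n) (Fin n) ℂ) * (u : Matrix (Fin n) (Fin n) ℂ) = 1 := by
  rw [← Matrix.SpecialLinearGroup.coe_mul, inv_mul_cancel, Matrix.SpecialLinearGroup.coe_one]

theorem mem_centralExtension {g : G} {u : Matrix.SpecialLinearGroup (Fin n) ℂ} :
    (g, u) ∈ centralExtension G n ↔ ∀ a : Matrix (Fin n) (Fin n) ℂ,
      g • a = (u : Matrix (Fin n) (Fin n) ℂ) * a * ((u⁻¹ :) : Matrix (Fin n) (Fin n) ℂ) := Iff.rfl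

theorem smul_mul_coe {g : G} {u : Matrix.SpecialLinearGroup (Fin n) ℂ}
    (hu : (g, u) ∈ centralExtension G n) (a : Matrix (Fin n) (Fin n) ℂ) :
    g • a * (u : Matrix (Fin n) (Fin n) ℂ) = u * a := by
  rw [mem_centralExtension.1 hu, mul_assoc, coe_inv_mul_coe, mul_one]

theorem coe_inv_mul_smul {g : G} {u : Matrix.SpecialLinearGroup (Fin n) ℂ}
    (hu : (g, u) ∈ centralExtension G n) (a : Matrix (Fin n) (Fin n) ℂ) :
    ((u⁻¹ :) : Matrix (Fin n) (Fin n) ℂ) * g • a =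
      a * ((u⁻¹ :) : Matrix (Fin n) (Fin n) ℂ) := by
  rw [mem_centralExtension.1 hu, ← mul_assoc, ← mul_assoc, coe_inv_mul_coe, one_mul]

/-- The characters through which `G` acts on the matrices `u` with `(g, u)` in the central
extension. -/
def pairingSubgroup (G : Type u) [CommGroup G] (n : ℕ)
    [MulSemiringAction G (Matrix (Fin n) (Fin n) ℂ)]
    [SMulCommClass G ℂ (Matrix (Fin n) (Fin n) ℂ)] : Subgroup (G →* ℂˣ) where
  carrier := {χ | ∃ g, ∃ u : Matrix.SpecialLinearGroup (Fin n) ℂ, (g, u) ∈ centralExtension G n ∧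
    ∀ h : G, h • (u : Matrix (Fin n) (Fin n) ℂ) = (χ h : ℂ) • (u : Matrix (Fin n) (Fin n) ℂ)}
  one_mem' := ⟨1, 1, one_mem (centralExtension G n), fun h => by simp⟩
  mul_mem' := by
    rintro χ ψ ⟨g, u, hu, hχ⟩ ⟨h, w, hw, hψ⟩
    refine ⟨g * h, u * w, mul_mem hu hw, fun k => ?_⟩
    rw [Matrix.SpecialLinearGroup.coe_mul, smul_mul', hχ, hψ, smul_mul_smul_comm,
      MonoidHom.mul_apply, Units.val_mul]
  inv_mem' := by
    rintro χ ⟨g, u, hu, hχ⟩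
    refine ⟨g⁻¹, u⁻¹, inv_mem hu, fun k => ?_⟩
    have h1 : (χ k : ℂ) • ((u : Matrix (Fin n) (Fin n) ℂ) *
        k • ((u⁻¹ :) : Matrix (Fin n) (Fin n) ℂ)) = 1 := by
      rw [← smul_mul_assoc, ← hχ, ← smul_mul', coe_mul_coe_inv, smul_one]
    have h2 : (u : Matrix (Fin n) (Fin n) ℂ) * k • ((u⁻¹ :) : Matrix (Fin n) (Fin n) ℂ) =
        ((χ k)⁻¹ : ℂˣ).val • 1 := by
      rw [← h1, smul_smul, ← Units.val_mul, inv_mul_cancel, Units.val_one, one_smul]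
    calc k • ((u⁻¹ :) : Matrix (Fin n) (Fin n) ℂ)
        = ((u⁻¹ :) : Matrix (Fin n) (Fin n) ℂ) * ((u : Matrix (Fin n) (Fin n) ℂ) *
          k • ((u⁻¹ :) : Matrix (Fin n) (Fin n) ℂ)) := by
          rw [← mul_assoc, coe_inv_mul_coe, one_mul]
      _ = _ := by rw [h2, mul_smul_comm, mul_one]; rfl

/-- The element `u⁻¹ g` of the crossed product, a unit centralizing the matrices when `(g, u)` lies
in the central extension. -/
def twistUnit (g : G) (u : Matrix.SpecialLinearGroup (Fin n) ℂ) : (CrossedProduct G n)ˣ where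
  val := single g ((u⁻¹ :) : Matrix (Fin n) (Fin n) ℂ)
  inv := single g⁻¹ (g⁻¹ • (u : Matrix (Fin n) (Fin n) ℂ))
  val_inv := by
    rw [single_mul_single, smul_inv_smul, coe_inv_mul_coe, mul_inv_cancel, single_one_one]
  inv_val := by
    rw [single_mul_single, ← smul_mul', coe_mul_coe_inv, smul_one, inv_mul_cancel, single_one_one]

theorem twistUnit_mul_single {g : G} {u : Matrix.SpecialLinearGroup (Fin n) ℂ}
    (hu : (g, u) ∈ centralExtension G n) (h : G) (a : Matrix (Fin n) (Fin n) ℂ) :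
    (twistUnit g u : CrossedProduct G n) * single h a =
      single (g * h) (a * ((u⁻¹ :) : Matrix (Fin n) (Fin n) ℂ)) := by
  rw [← coe_inv_mul_smul hu]
  exact single_mul_single ..

variable [SMulCommClass G ℂ (Matrix (Fin n) (Fin n) ℂ)]

/-- Every element of `G` lifts to the central extension. -/
theorem exists_mem_centralExtension (hn : 0 < n) (g : G) :
    ∃ u : Matrix.SpecialLinearGroup (Fin n) ℂ, (g, u) ∈ centralExtension G n := by
  let α : Matrix (Fin n) (Fin n) ℂ ≃ₐ[ℂ] Matrix (Fin n) (Fin n) ℂ :=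
    MulSemiringAction.toAlgEquiv ℂ (Matrix (Fin n) (Fin n) ℂ) g
  let τ : Matrix (Fin n) (Fin n) ℂ ≃ₐ[ℂ] Module.End ℂ (Fin n → ℂ) := Matrix.toLinAlgEquiv'
  obtain ⟨T, hT⟩ := ((τ.symm.trans α).trans τ).eq_linearEquivConjAlgEquiv
  let U : Matrix (Fin n) (Fin n) ℂ := τ.symm T.toLinearMap
  let U' : Matrix (Fin n) (Fin n) ℂ := τ.symm T.symm.toLinearMap
  have hUU' : U * U' = 1 := by
    rw [← map_mul, ← map_one τ.symm]
    congr 1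
    exact LinearMap.ext fun x => T.apply_symm_apply x
  have hconj : ∀ a, g • a = U * a * U' := fun a => by
    have h1 : τ (g • a) = LinearEquiv.conjAlgEquiv ℂ T (τ a) := by
      have := DFunLike.congr_fun hT (τ a)
      simpa [α] using this
    apply τ.injective
    rw [h1, map_mul, map_mul, AlgEquiv.apply_symm_apply, AlgEquiv.apply_symm_apply]
    rfl
  have hdet : U.det ≠ 0 := fun h => by
    have := congrArg Matrix.det hUU'
    rw [Matrix.det_mul, h, zero_mul, Matrix.det_one] at this
    exact zero_ne_one this
  obtain ⟨c, hc⟩ := IsAlgClosed.exists_pow_nat_eq U.det hn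
  have hc0 : c ≠ 0 := by
    rintro rfl
    rw [zero_pow hn.ne'] at hc
    exact hdet hc.symm
  let u : Matrix.SpecialLinearGroup (Fin n) ℂ := ⟨c⁻¹ • U, by
    rw [Matrix.det_smul, Fintype.card_fin, ← hc, inv_pow, inv_mul_cancel₀ (pow_ne_zero n hc0)]⟩
  have hu : (u : Matrix (Fin n) (Fin n) ℂ) = c⁻¹ • U := rfl
  have hu' : ((u⁻¹ :) : Matrix (Fin n) (Fin n) ℂ) = c • U' := by
    have h1 : (u : Matrix (Fin n) (Fin n) ℂ) * (c • U') = 1 := by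
      rw [hu, smul_mul_smul_comm, inv_mul_cancel₀ hc0, hUU', one_smul]
    calc ((u⁻¹ :) : Matrix (Fin n) (Fin n) ℂ)
        = ((u⁻¹ :) : Matrix (Fin n) (Fin n) ℂ) *
          ((u : Matrix (Fin n) (Fin n) ℂ) * (c • U')) := by rw [h1, mul_one]
      _ = c • U' := by rw [← mul_assoc, coe_inv_mul_coe, one_mul]
  refine ⟨u, fun a => ?_⟩
  change g • a = (u : Matrix (Fin n) (Fin n) ℂ) * a * ((u⁻¹ :) : Matrix (Fin n) (Fin n) ℂ)
  rw [hconj, hu, hu', smul_mul_assoc, smul_mul_smul_comm, inv_mul_cancel₀ hc0, one_smul]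

/-- `G` acts on a matrix `u` with `(g, u)` in the central extension through a character. -/
theorem exists_character_smul_eq (hn : 0 < n) {g : G} {u : Matrix.SpecialLinearGroup (Fin n) ℂ}
    (hu : (g, u) ∈ centralExtension G n) : ∃ χ : G →* ℂˣ, ∀ h : G,
      h • (u : Matrix (Fin n) (Fin n) ℂ) = (χ h : ℂ) • (u : Matrix (Fin n) (Fin n) ℂ) := by
  have : Nonempty (Fin n) := ⟨⟨0, hn⟩⟩
  have hu0 : (u : Matrix (Fin n) (Fin n) ℂ) ≠ 0 := fun h => by
    have := coe_mul_coe_inv u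
    rw [h, zero_mul] at this
    exact zero_ne_one this
  have hscalar : ∀ h : G, ∃ c : ℂ,
      h • (u : Matrix (Fin n) (Fin n) ℂ) = c • (u : Matrix (Fin n) (Fin n) ℂ) := fun h => by
    have hcomm : ∀ a : Matrix (Fin n) (Fin n) ℂ, Commute a
        (((u⁻¹ :) : Matrix (Fin n) (Fin n) ℂ) * h • (u : Matrix (Fin n) (Fin n) ℂ)) := fun a => by
      have h1 : (g • a) * h • (u : Matrix (Fin n) (Fin n) ℂ) =
          h • (u : Matrix (Fin n) (Fin n) ℂ) * a := by
        have h2 := congrArg (h • ·) (smul_mul_coe hu (h⁻¹ • a))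
        simpa only [smul_mul', smul_inv_smul, smul_comm h g (h⁻¹ • a)] using h2
      rw [commute_iff_eq, mul_assoc, ← h1, ← mul_assoc, ← mul_assoc, coe_inv_mul_smul hu]
    obtain ⟨c, hc⟩ := Matrix.mem_range_scalar_iff_commute_single'.2
      fun i j => hcomm (Matrix.single i j 1)
    refine ⟨c, ?_⟩
    calc h • (u : Matrix (Fin n) (Fin n) ℂ)
        = (u : Matrix (Fin n) (Fin n) ℂ) * (((u⁻¹ :) : Matrix (Fin n) (Fin n) ℂ) *
          h • (u : Matrix (Fin n) (Fin n) ℂ)) := by rw [← mul_assoc, coe_mul_coe_inv, one_mul]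
      _ = _ := by rw [← hc, Matrix.scalar_apply, ← Matrix.smul_one_eq_diagonal, mul_smul_comm,
                    mul_one]
  choose c hc using hscalar
  let κ : G →* ℂ :=
    { toFun := c
      map_one' := smul_left_injective ℂ hu0 (by
        change c 1 • (u : Matrix (Fin n) (Fin n) ℂ) = (1 : ℂ) • (u : Matrix (Fin n) (Fin n) ℂ)
        rw [← hc, one_smul, one_smul])
      map_mul' := fun h k => smul_left_injective ℂ hu0 (by
        change c (h * k) • (u : Matrix (Fin n) (Fin n) ℂ) =
          (c h * c k) • (u : Matrix (Fin n) (Fin n) ℂ)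
        rw [← hc, mul_smul, hc k, smul_comm h, hc h, smul_smul, mul_comm]) }
  exact ⟨κ.toHomUnits, fun h => hc h⟩

/-- An element on which all characters of the pairing vanish lifts to the center. -/
theorem mem_centerImage_of_pairing (hn : 0 < n) {h : G}
    (hh : ∀ φ ∈ pairingSubgroup G n, φ h = 1) : h ∈ centerImage G n := by
  obtain ⟨w, hw⟩ := exists_mem_centralExtension hn h
  refine ⟨⟨(h, w), hw⟩, ?_, rfl⟩
  refine Subgroup.mem_center_iff.2 ?_
  rintro ⟨⟨g, u⟩, hu⟩
  obtain ⟨χ, hχ⟩ := exists_character_smul_eq hn hu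
  have h1 : h • (u : Matrix (Fin n) (Fin n) ℂ) = u := by
    rw [hχ, hh χ ⟨g, u, hu, hχ⟩, Units.val_one, one_smul]
  refine Subtype.ext (Prod.ext (mul_comm g h) ?_)
  apply Subtype.ext
  change (u : Matrix (Fin n) (Fin n) ℂ) * w = w * u
  rw [← smul_mul_coe hw, h1]

/-- A character that vanishes on the image of the center belongs to the pairing. -/
theorem mem_pairingSubgroup [Finite G] (hn : 0 < n) {χ : G →* ℂˣ}
    (hχ : ∀ g ∈ centerImage G n, χ g = 1) : χ ∈ pairingSubgroup G n := by
  let Θ := CommGroup.subgroupOrderIsoSubgroupMonoidHom G ℂ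
  have h1 : (Θ (Θ.symm (OrderDual.toDual (pairingSubgroup G n)))).ofDual = pairingSubgroup G n := by
    rw [OrderIso.apply_symm_apply]; rfl
  rw [← h1, CommGroup.mem_subgroupOrderIsoSubgroupMonoidHom_iff]
  intro g hg
  rw [CommGroup.mem_subgroupOrderIsoSubgroupMonoidHom_symm_iff] at hg
  exact hχ g (mem_centerImage_of_pairing hn hg)

/-- A matrix in the center of the central extension is fixed by `G`. -/
theorem smul_coe_of_mem_center (hn : 0 < n) {p : centralExtension G n}
    (hp : p ∈ Subgroup.center (centralExtension G n)) (h : G) :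
    h • (p.1.2 : Matrix (Fin n) (Fin n) ℂ) = p.1.2 := by
  obtain ⟨w, hw⟩ := exists_mem_centralExtension hn h
  have h1 := congrArg (fun q : centralExtension G n => (q.1.2 : Matrix (Fin n) (Fin n) ℂ))
    (Subgroup.mem_center_iff.1 hp ⟨(h, w), hw⟩)
  have h2 : (w : Matrix (Fin n) (Fin n) ℂ) * p.1.2 = p.1.2 * w := h1
  rw [mem_centralExtension.1 hw, h2, mul_assoc, coe_mul_coe_inv, mul_one]

theorem single_mul_twistUnit {g : G} {u : Matrix.SpecialLinearGroup (Fin n) ℂ}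
    {χ : G →* ℂˣ} (hχ : ∀ h : G, h • (u : Matrix (Fin n) (Fin n) ℂ) =
      (χ h : ℂ) • (u : Matrix (Fin n) (Fin n) ℂ)) (hu : (g, u) ∈ centralExtension G n)
    (h : G) (a : Matrix (Fin n) (Fin n) ℂ) :
    (χ h : ℂ) • ((single h a : CrossedProduct G n) * twistUnit g u) =
      twistUnit g u * single h a := by
  have h1 : (χ h : ℂ) • h • ((u⁻¹ :) : Matrix (Fin n) (Fin n) ℂ) =
      ((u⁻¹ :) : Matrix (Fin n) (Fin n) ℂ) := by
    have h2 : (h • ((u⁻¹ :) : Matrix (Fin n) (Fin n) ℂ)) * ((χ h : ℂ) •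
        (u : Matrix (Fin n) (Fin n) ℂ)) = 1 := by
      rw [← hχ, ← smul_mul', coe_inv_mul_coe, smul_one]
    calc (χ h : ℂ) • h • ((u⁻¹ :) : Matrix (Fin n) (Fin n) ℂ)
        = (h • ((u⁻¹ :) : Matrix (Fin n) (Fin n) ℂ)) * ((χ h : ℂ) •
          (u : Matrix (Fin n) (Fin n) ℂ)) * ((u⁻¹ :) : Matrix (Fin n) (Fin n) ℂ) := by
          rw [mul_smul_comm, smul_mul_assoc, mul_assoc, coe_mul_coe_inv, mul_one]
      _ = _ := by rw [h2, one_mul]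
  have h3 : (single h a : CrossedProduct G n) * twistUnit g u =
      single (h * g) (a * h • ((u⁻¹ :) : Matrix (Fin n) (Fin n) ℂ)) := single_mul_single ..
  rw [twistUnit_mul_single hu, h3, smul_single, ← mul_smul_comm, h1, mul_comm h g]

variable [Finite G]

theorem charClass_smul_eq_self (hn : 0 < n) {χ : G →* ℂˣ} (hχ : ∀ g ∈ centerImage G n, χ g = 1)
    (E : FGProj (CrossedProduct G n)) :
    charClass χ • ProjClass.mk E = ProjClass.mk E := by
  obtain ⟨g, u, hu, h⟩ := inv_mem (mem_pairingSubgroup hn hχ)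
  let f : E.carrier →ₗ[ℂ] E.carrier :=
    Algebra.lsmul ℂ ℂ E.carrier (twistUnit g u : CrossedProduct G n)
  have hf : ∀ x, f x = (twistUnit g u : CrossedProduct G n) • x := fun _ => rfl
  refine charClass_smul_eq_of_isTwisted (f := f) (fun k a x => ?_) ?_
  · rw [hf, hf, smul_smul, smul_smul, ← single_mul_twistUnit h hu, smul_assoc, smul_smul,
      ← Units.val_mul, MonoidHom.inv_apply, mul_inv_cancel, Units.val_one, one_smul]
  · exact MulAction.bijective (twistUnit g u)

theorem eq_one_of_charClass_smul_eq_self (hn : 0 < n) {χ : G →* ℂˣ}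
    (E : FGProj (CrossedProduct G n)) [IsSimpleModule (CrossedProduct G n) E.carrier]
    (hE : charClass χ • ProjClass.mk E = ProjClass.mk E) : ∀ g ∈ centerImage G n, χ g = 1 := by
  rintro _ ⟨⟨⟨g, u⟩, hu⟩, hp, rfl⟩
  change χ g = 1
  have hfix : ∀ h : G, h • (u : Matrix (Fin n) (Fin n) ℂ) =
      (((1 : G →* ℂˣ) h : ℂˣ) : ℂ) • (u : Matrix (Fin n) (Fin n) ℂ) := fun h => by
    rw [MonoidHom.one_apply, Units.val_one, one_smul]
    exact smul_coe_of_mem_center hn hp h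
  have hcentral : ∀ b : CrossedProduct G n, b * twistUnit g u = twistUnit g u * b := fun b => by
    induction b using SkewMonoidAlgebra.induction_on with
    | zero => rw [zero_mul, mul_zero]
    | add b c hb hc => rw [add_mul, mul_add, hb, hc]
    | single h a =>
      rw [← single_mul_twistUnit hfix hu, MonoidHom.one_apply, Units.val_one, one_smul]
  have : Module.Finite ℂ E.carrier := Module.Finite.trans (CrossedProduct G n) E.carrier
  let φ : Module.End (CrossedProduct G n) E.carrier :=
    { toFun := fun x => (twistUnit g u : CrossedProduct G n) • x
      map_add' := fun x y => smul_add _ x y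
      map_smul' := fun b x => by rw [smul_smul, ← hcentral, mul_smul]; rfl }
  obtain ⟨c, hc⟩ :=
    (IsSimpleModule.algebraMap_end_bijective_of_isAlgClosed (A := CrossedProduct G n)
      (V := E.carrier) ℂ).2 φ
  have hc' : ∀ x : E.carrier, (twistUnit g u : CrossedProduct G n) • x = c • x := fun x =>
    (LinearMap.congr_fun hc x).symm
  obtain ⟨f, hf, hbij⟩ := exists_isTwisted_of_charClass_smul_eq hE
  have := IsSimpleModule.nontrivial (CrossedProduct G n) E.carrier
  obtain ⟨x, hx⟩ := exists_ne (0 : E.carrier)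
  have hfx : f x ≠ 0 := fun h => hx (hbij.1 (h.trans (map_zero f).symm))
  have h1 : (χ g : ℂ) • f ((twistUnit g u : CrossedProduct G n) • x) =
      (twistUnit g u : CrossedProduct G n) • f x := hf g _ x
  have hcfx : c • f x ≠ 0 := by
    rw [← hc']
    exact fun h => hfx ((smul_eq_zero_iff_eq (twistUnit g u)).1 h)
  rw [hc', hc', map_smul] at h1
  have h2 : ((χ g : ℂ) - 1) • c • f x = 0 := by rw [sub_smul, one_smul, h1, sub_self]
  exact Units.ext (sub_eq_zero.1 ((smul_eq_zero.1 h2).resolve_right hcfx))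

end MatrixPairing

/-! ### `K₀` of the crossed product -/

theorem tmul_smul_repRing_tmul {G : Type u} [Group G] {H : Subgroup G} (r : RepRing G) (p : ℚ) (x : RepRing H) (q : ℚ) :
    (r ⊗ₜ[ℤ] p : RepRing G ⊗[ℤ] ℚ) • (x ⊗ₜ[ℤ] q : RepRing H ⊗[ℤ] ℚ) =
      (RepRing.res H r * x) ⊗ₜ[ℤ] (p * q) := by
  change Algebra.TensorProduct.map (RepRing.res H).toIntAlgHom (AlgHom.id ℤ ℚ) (r ⊗ₜ[ℤ] p) *
    x ⊗ₜ[ℤ] q = _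
  rw [Algebra.TensorProduct.map_tmul, Algebra.TensorProduct.tmul_mul_tmul]
  rfl

section Multiplicity

variable {G : Type u} [CommGroup G] [Finite G] {A : Type v} [Ring A] [Algebra ℂ A]
  [MulSemiringAction G A] [SMulCommClass G ℂ A] [Module.Finite ℂ A]

theorem finite_hom_crossed (S P : FGProj (SkewMonoidAlgebra A G)) :
    Module.Finite ℂ (S.carrier →ₗ[SkewMonoidAlgebra A G] P.carrier) := by
  have : Module.Finite ℂ S.carrier := Module.Finite.trans (SkewMonoidAlgebra A G) S.carrier
  have : Module.Finite ℂ P.carrier := Module.Finite.trans (SkewMonoidAlgebra A G) P.carrier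
  exact .of_injective (LinearMap.restrictScalarsₗ ℂ (SkewMonoidAlgebra A G) S.carrier P.carrier ℂ)
    (LinearMap.restrictScalars_injective _)

/-- The dimension of the space of homomorphisms from `S`, an additive invariant of modules over the
crossed product. -/
def homMult (S : FGProj (SkewMonoidAlgebra A G)) : ProjClass (SkewMonoidAlgebra A G) →+ ℕ where
  toFun := Quotient.lift
    (fun P => Module.finrank ℂ (S.carrier →ₗ[SkewMonoidAlgebra A G] P.carrier)) (by
      rintro P Q ⟨e⟩
      exact LinearEquiv.finrank_eq
        { toFun := fun f => e.toLinearMap ∘ₗ f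
          invFun := fun f => e.symm.toLinearMap ∘ₗ f
          left_inv := fun f => LinearMap.ext fun x => e.symm_apply_apply _
          right_inv := fun f => LinearMap.ext fun x => e.apply_symm_apply _
          map_add' := fun f g => LinearMap.ext fun x => map_add e _ _
          map_smul' := fun c f => LinearMap.ext fun x =>
            (e.toLinearMap.restrictScalars ℂ).map_smul c (f x) })
  map_zero' := by
    have : Subsingleton (FGProj.zero (R := SkewMonoidAlgebra A G)).carrier :=
      inferInstanceAs (Subsingleton PUnit)
    exact Module.finrank_zero_of_subsingleton (R := ℂ)
      (M := S.carrier →ₗ[SkewMonoidAlgebra A G] (FGProj.zero (R := SkewMonoidAlgebra A G)).carrier)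
  map_add' a b := by
    induction a using Quotient.inductionOn with | _ P
    induction b using Quotient.inductionOn with | _ Q
    change Module.finrank ℂ (S.carrier →ₗ[SkewMonoidAlgebra A G] (P.sum Q).carrier) =
      Module.finrank ℂ (S.carrier →ₗ[SkewMonoidAlgebra A G] P.carrier) +
      Module.finrank ℂ (S.carrier →ₗ[SkewMonoidAlgebra A G] Q.carrier)
    have := finite_hom_crossed S P
    have := finite_hom_crossed S Q
    rw [← Module.finrank_prod]
    exact LinearEquiv.finrank_eq
      { toFun := fun f => (LinearMap.fst (SkewMonoidAlgebra A G) P.carrier Q.carrier ∘ₗ f,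
          LinearMap.snd (SkewMonoidAlgebra A G) P.carrier Q.carrier ∘ₗ f)
        invFun := fun f => f.1.prod f.2
        left_inv := fun f => rfl
        right_inv := fun f => rfl
        map_add' := fun f g => rfl
        map_smul' := fun c f => rfl }

theorem homMult_mk_self (S : FGProj (SkewMonoidAlgebra A G))
    [IsSimpleModule (SkewMonoidAlgebra A G) S.carrier] : homMult S (ProjClass.mk S) = 1 := by
  have : Module.Finite ℂ S.carrier := Module.Finite.trans (SkewMonoidAlgebra A G) S.carrier
  change Module.finrank ℂ (Module.End (SkewMonoidAlgebra A G) S.carrier) = 1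
  rw [← (LinearEquiv.ofBijective
    (Algebra.linearMap ℂ (Module.End (SkewMonoidAlgebra A G) S.carrier))
    (IsSimpleModule.algebraMap_end_bijective_of_isAlgClosed ℂ)).finrank_eq, Module.finrank_self]

theorem homMult_mk_of_ne (S T : FGProj (SkewMonoidAlgebra A G))
    [IsSimpleModule (SkewMonoidAlgebra A G) S.carrier]
    [IsSimpleModule (SkewMonoidAlgebra A G) T.carrier] (h : ProjClass.mk S ≠ ProjClass.mk T) :
    homMult S (ProjClass.mk T) = 0 := by
  have : Subsingleton (S.carrier →ₗ[SkewMonoidAlgebra A G] T.carrier) := by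
    refine subsingleton_of_forall_eq 0 fun f => ?_
    refine f.bijective_or_eq_zero.resolve_left fun hf => h ?_
    exact ProjClass.mk_eq_mk.2 ⟨.ofBijective f hf⟩
  exact Module.finrank_zero_of_subsingleton (R := ℂ)
    (M := S.carrier →ₗ[SkewMonoidAlgebra A G] T.carrier)

variable [IsSemisimpleRing A]

/-- The classes of modules over the crossed product are generated by those of simple modules. -/
theorem closure_simple_eq_top : AddSubmonoid.closure
    {a : ProjClass (SkewMonoidAlgebra A G) | ∃ S : FGProj (SkewMonoidAlgebra A G),
      IsSimpleModule (SkewMonoidAlgebra A G) S.carrier ∧ ProjClass.mk S = a} = ⊤ := by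
  have := crossed_isSemisimpleRing (G := G) (A := A)
  suffices h : ∀ (d : ℕ) (P : FGProj (SkewMonoidAlgebra A G)), Module.finrank ℂ P.carrier = d →
      ProjClass.mk P ∈ AddSubmonoid.closure
        {a : ProjClass (SkewMonoidAlgebra A G) | ∃ S : FGProj (SkewMonoidAlgebra A G),
          IsSimpleModule (SkewMonoidAlgebra A G) S.carrier ∧ ProjClass.mk S = a} by
    rw [eq_top_iff]
    intro a _
    induction a using Quotient.inductionOn with | _ P
    exact h _ P rfl
  intro d
  induction d using Nat.strong_induction_on with | _ d ih
  intro P hP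
  rcases subsingleton_or_nontrivial P.carrier with hs | hs
  · have : Subsingleton (FGProj.zero (R := SkewMonoidAlgebra A G)).carrier :=
      inferInstanceAs (Subsingleton PUnit)
    have : ProjClass.mk P = 0 := ProjClass.mk_eq_mk.2 ⟨LinearEquiv.ofSubsingleton P.carrier
      (FGProj.zero (R := SkewMonoidAlgebra A G)).carrier⟩
    rw [this]
    exact zero_mem _
  obtain ⟨S, hS⟩ := IsSemisimpleModule.exists_simple_submodule (SkewMonoidAlgebra A G) P.carrier
  obtain ⟨Q, hQ⟩ := exists_isCompl S
  have := crossed_projective (A := A) (G := G) S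
  have := crossed_projective (A := A) (G := G) Q
  let S' : FGProj (SkewMonoidAlgebra A G) := ⟨S⟩
  let Q' : FGProj (SkewMonoidAlgebra A G) := ⟨Q⟩
  let e : (S'.sum Q').carrier ≃ₗ[SkewMonoidAlgebra A G] P.carrier :=
    Submodule.prodEquivOfIsCompl S Q hQ
  have hPS : ProjClass.mk P = ProjClass.mk S' + ProjClass.mk Q' :=
    (ProjClass.mk_eq_mk.2 ⟨e⟩ : ProjClass.mk (S'.sum Q') = ProjClass.mk P).symm
  have hfin : Module.finrank ℂ Q'.carrier < d := by
    have : Module.Finite ℂ S'.carrier := Module.Finite.trans (SkewMonoidAlgebra A G) S'.carrier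
    have : Module.Finite ℂ Q'.carrier := Module.Finite.trans (SkewMonoidAlgebra A G) Q'.carrier
    have : Nontrivial S'.carrier := IsSimpleModule.nontrivial (SkewMonoidAlgebra A G) S
    have h1 : Module.finrank ℂ (S'.carrier × Q'.carrier) = Module.finrank ℂ P.carrier :=
      LinearEquiv.finrank_eq
        { e with map_smul' := fun c x => (e.toLinearMap.restrictScalars ℂ).map_smul c x }
    rw [Module.finrank_prod, hP] at h1
    have := Module.finrank_pos (R := ℂ) (M := S'.carrier)
    omega
  rw [hPS]
  exact add_mem (AddSubmonoid.subset_closure ⟨S', hS, rfl⟩) (ih _ hfin Q' rfl)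

end Multiplicity

section KZeroCrossed

variable {G : Type u} [CommGroup G] [Finite G] {n : ℕ}
  [MulSemiringAction G (Matrix (Fin n) (Fin n) ℂ)]
  [SMulCommClass G ℂ (Matrix (Fin n) (Fin n) ℂ)]

variable (G) in
theorem exists_simple_fgProj (hn : 0 < n) :
    ∃ E : FGProj (CrossedProduct G n), IsSimpleModule (CrossedProduct G n) E.carrier := by
  have : Nonempty (Fin n) := ⟨⟨0, hn⟩⟩
  obtain ⟨m, hm⟩ := Ideal.exists_maximal (CrossedProduct G n)
  have := crossed_projective (A := Matrix (Fin n) (Fin n) ℂ) (G := G) (CrossedProduct G n ⧸ m)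
  exact ⟨⟨CrossedProduct G n ⧸ m⟩, isSimpleModule_iff_isCoatom.2 hm.out⟩

/-- `K₀` of the crossed product has a basis indexed by the characters of the image of the center,
on which the characters of `G` act through restriction and multiplication. -/
theorem exists_K0_basis (hn : 0 < n) :
    ∃ β : Module.Basis (centerImage G n →* ℂˣ) ℤ (K0 (CrossedProduct G n)),
      ∀ (χ : G →* ℂˣ) ψ, (GrothendieckAddGroup.of (charClass χ) : RepRing G) • β ψ =
        β (χ.comp (centerImage G n).subtype * ψ) := by
  classical
  have : Nonempty (Fin n) := ⟨⟨0, hn⟩⟩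
  obtain ⟨E, hE⟩ := exists_simple_fgProj G hn
  have hsurj := MonoidHom.domRestrict_surjective (M := ℂ) (centerImage G n)
  choose ext hext using hsurj
  have hext_apply : ∀ ψ (g : centerImage G n), ext ψ g = ψ g := fun ψ g => DFunLike.congr_fun (hext ψ) g
  let b : (centerImage G n →* ℂˣ) → ProjClass (CrossedProduct G n) := fun ψ =>
    charClass (ext ψ) • ProjClass.mk E
  have hb : ∀ χ : G →* ℂˣ,
      charClass χ • ProjClass.mk E = b (χ.comp (centerImage G n).subtype) := fun χ => by
    have h1 := charClass_smul_eq_self hn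
      (χ := (ext (χ.comp (centerImage G n).subtype))⁻¹ * χ) (fun g hg => by
        have h2 := hext_apply (χ.comp (centerImage G n).subtype) ⟨g, hg⟩
        change (ext (χ.comp (centerImage G n).subtype) g)⁻¹ * χ g = 1
        rw [h2]
        exact inv_mul_cancel _) E
    change _ = charClass (ext (χ.comp (centerImage G n).subtype)) • ProjClass.mk E
    conv_rhs => rw [← h1]
    have h2 : ext (χ.comp (centerImage G n).subtype) *
        ((ext (χ.comp (centerImage G n).subtype))⁻¹ * χ) = χ := mul_inv_cancel_left _ _
    rw [smul_smul, charClass_mul, h2]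
  have hinj : Function.Injective b := fun ψ φ h => by
    have h1 : charClass ((ext φ)⁻¹ * ext ψ) • ProjClass.mk E = ProjClass.mk E := by
      rw [← charClass_mul, mul_smul]
      change _ • b ψ = _
      have h2 : (ext φ)⁻¹ * ext φ = 1 := inv_mul_cancel _
      rw [h, smul_smul, charClass_mul, h2, charClass_one, one_smul]
    have h2 := eq_one_of_charClass_smul_eq_self hn E h1
    refine MonoidHom.ext fun g => ?_
    have h3 : (ext φ g)⁻¹ * ext ψ g = 1 := h2 g g.2
    rw [hext_apply, hext_apply] at h3
    exact (inv_mul_eq_one.1 h3).symm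
  let S : (centerImage G n →* ℂˣ) → FGProj (CrossedProduct G n) := fun ψ =>
    twist (charRep (ext ψ)) E
  have hS : ∀ ψ, IsSimpleModule (CrossedProduct G n) (S ψ).carrier := fun ψ =>
    isSimpleModule_twist (ext ψ) E
  have hSb : ∀ ψ, ProjClass.mk (S ψ) = b ψ := fun ψ => rfl
  obtain ⟨β, hβ⟩ := exists_groth_basis b (fun ψ => homMult (S ψ)) (fun ψ φ => by
      split_ifs with h
      · rw [← h, ← hSb, homMult_mk_self]
      · rw [← hSb, homMult_mk_of_ne]
        rw [hSb, hSb]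
        exact fun h' => h (hinj h')) (by
      rw [eq_top_iff, ← closure_simple_eq_top]
      refine AddSubmonoid.closure_mono ?_
      rintro _ ⟨F, hF, rfl⟩
      obtain ⟨χ, hχ⟩ := exists_charClass_smul_eq E F
      exact ⟨_, (hb χ).symm.trans hχ⟩)
  refine ⟨β, fun χ ψ => ?_⟩
  rw [hβ, hβ]
  refine (grothAct_of_of (S := RepClass G) (M := ProjClass (CrossedProduct G n)) _ _).trans ?_
  congr 1
  change charClass χ • charClass (ext ψ) • ProjClass.mk E = _
  rw [smul_smul, charClass_mul, hb]
  congr 1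
  refine MonoidHom.ext fun g => ?_
  change χ g * ext ψ g = χ g * ψ g
  rw [hext_apply]

/-- `K₀` of the crossed product is isomorphic to the representation ring of the image of the center,
compatibly with the action of the representation ring of `G`. -/
theorem exists_K0_equiv_repRing (hn : 0 < n) :
    ∃ T : K0 (CrossedProduct G n) ≃ₗ[ℤ] RepRing (centerImage G n),
      ∀ (r : RepRing G) x, T (r • x) = RepRing.res (centerImage G n) r * T x := by
  obtain ⟨β, hβ⟩ := exists_K0_basis (G := G) hn
  obtain ⟨γ, hγ⟩ := exists_repRing_basis (centerImage G n)
  obtain ⟨δ, hδ⟩ := exists_repRing_basis G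
  have hT : ∀ ψ, β.equiv γ (.refl _) (β ψ) = γ ψ := fun ψ => by
    rw [Module.Basis.equiv_apply, Equiv.refl_apply]
  refine ⟨β.equiv γ (.refl _), fun r x => ?_⟩
  induction δ.mem_span r using Submodule.span_induction with
  | zero => rw [zero_smul, map_zero, map_zero, zero_mul]
  | add r s _ _ hr hs => rw [add_smul, map_add, map_add, add_mul, hr, hs]
  | smul c r _ hr => rw [smul_assoc, map_zsmul, map_zsmul, hr, smul_mul_assoc]
  | mem r hr =>
    obtain ⟨χ, rfl⟩ := hr
    induction β.mem_span x using Submodule.span_induction with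
    | zero => rw [smul_zero, map_zero, mul_zero]
    | add x y _ _ hx hy => rw [smul_add, map_add, map_add, mul_add, hx, hy]
    | smul c x _ hx => rw [smul_comm, map_zsmul, map_zsmul, hx, mul_smul_comm]
    | mem x hx =>
      obtain ⟨ψ, rfl⟩ := hx
      rw [hδ, hβ, hT, hT, hγ, hγ, ← charClass_mul]
      have h1 : RepRing.res (centerImage G n) (GrothendieckAddGroup.of (charClass χ)) =
          GrothendieckAddGroup.of (charClass (χ.comp (centerImage G n).subtype)) :=
        groth_lift_of _ _
      rw [h1]
      exact (grothAct_of_of (S := RepClass (centerImage G n))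
        (M := RepClass (centerImage G n)) _ _).symm

theorem tmul_smul_K0_tmul (r : RepRing G) (p : ℚ) (x : K0 (CrossedProduct G n)) (q : ℚ) :
    (r ⊗ₜ[ℤ] p : RepRing G ⊗[ℤ] ℚ) • (x ⊗ₜ[ℤ] q : K0 (CrossedProduct G n) ⊗[ℤ] ℚ) =
      (r • x) ⊗ₜ[ℤ] (p * q) := by
  change Module.endTensorEndAlgHom (R := ℤ) (S := ℤ) (A := ℤ)
    (Algebra.TensorProduct.map (Algebra.lsmul ℤ ℤ (K0 (CrossedProduct G n)))
      (Algebra.lsmul ℤ ℤ ℚ) (r ⊗ₜ[ℤ] p)) (x ⊗ₜ[ℤ] q) = _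
  rw [Algebra.TensorProduct.map_tmul, Module.endTensorEndAlgHom_apply,
    TensorProduct.AlgebraTensorModule.map_tmul]
  rfl

theorem nonempty_K0_rat_equiv (hn : 0 < n) :
    Nonempty (K0 (CrossedProduct G n) ⊗[ℤ] ℚ ≃ₗ[RepRing G ⊗[ℤ] ℚ]
      RepRing (centerImage G n) ⊗[ℤ] ℚ) := by
  obtain ⟨T, hT⟩ := exists_K0_equiv_repRing (G := G) hn
  let e : K0 (CrossedProduct G n) ⊗[ℤ] ℚ ≃ₗ[ℤ] RepRing (centerImage G n) ⊗[ℤ] ℚ :=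
    TensorProduct.congr T (.refl ℤ ℚ)
  refine ⟨{ e with map_smul' := fun r x => ?_ }⟩
  change e (r • x) = r • e x
  induction r using TensorProduct.induction_on with
  | zero =>
    exact (congrArg e (zero_smul (RepRing G ⊗[ℤ] ℚ) x)).trans
      ((map_zero e).trans (zero_smul (RepRing G ⊗[ℤ] ℚ) (e x)).symm)
  | add r s hr hs => rw [add_smul, add_smul, map_add, hr, hs]
  | tmul r p =>
    induction x using TensorProduct.induction_on with
    | zero => rw [smul_zero, map_zero, smul_zero]
    | add x y hx hy => rw [smul_add, map_add, map_add, smul_add, hx, hy]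
    | tmul x q =>
      have he : ∀ x q, e (x ⊗ₜ[ℤ] q) = T x ⊗ₜ[ℤ] q := fun _ _ => rfl
      rw [tmul_smul_K0_tmul, he, he, tmul_smul_repRing_tmul, hT]

end KZeroCrossed

end TwistedK

end

theorem theorem6p14 {G : Type*} [CommGroup G] [Finite G] {n : ℕ} (hn : 0 < n)
    [MulSemiringAction G (Matrix (Fin n) (Fin n) ℂ)]
    [SMulCommClass G ℂ (Matrix (Fin n) (Fin n) ℂ)] :
    Subsingleton (TwistedK.K1 (TwistedK.CrossedProduct G n)) ∧
    Module.Free ℤ (TwistedK.K0 (TwistedK.CrossedProduct G n)) ∧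
    Module.Finite ℤ (TwistedK.K0 (TwistedK.CrossedProduct G n)) ∧
    Nonempty (TwistedK.RepRing G ⊗[ℤ] ℚ ≃+* MonoidAlgebra ℚ G) ∧
    Nonempty (TwistedK.K0 (TwistedK.CrossedProduct G n) ⊗[ℤ] ℚ
      ≃ₗ[TwistedK.RepRing G ⊗[ℤ] ℚ]
        TwistedK.RepRing (TwistedK.centerImage G n) ⊗[ℤ] ℚ) ∧
    Module.finrank ℤ (TwistedK.K0 (TwistedK.CrossedProduct G n)) ∣ Nat.card G := by
  obtain ⟨β, -⟩ := TwistedK.exists_K0_basis (G := G) hn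
  refine ⟨TwistedK.subsingleton_K1 _, .of_basis β, .of_basis β,
    TwistedK.nonempty_repRing_rat_equiv G, TwistedK.nonempty_K0_rat_equiv hn, ?_⟩
  rw [Module.finrank_eq_nat_card_basis β,
    CommGroup.card_monoidHom_of_hasEnoughRootsOfUnity (TwistedK.centerImage G n) ℂ]
  exact Subgroup.card_subgroup_dvd_card _
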